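/- **Setting.** Fix a set of atoms with an involution $a\mapsto\bar a$ such that $\bar a\neq a$ for all $a$. Formulae are built freely from the units $\mathsf f,\mathsf t$ and the atoms by disjunction $[\alpha\,.\,\beta]$ and conjunction $(\alpha\,.\,\beta)$. A derivation of $\mathsf{SKS}$ from its premiss to its conclusion is a finite chain of inference steps, each of which applies, inside an arbitrary context, an instance of one of the following rules: $\mathsf{ai}{\downarrow}\colon\mathsf t\to[a\,.\,\bar a]$; $\mathsf{ai}{\uparrow}\colon(a\,.\,\bar a)\to\mathsf f$; $\mathsf{aw}{\downarrow}\colon\mathsf f\to a$; $\mathsf{aw}{\uparrow}\colon a\to\mathsf t$; $\mathsf{ac}{\downarrow}\colon[a\,.\,a]\to a$; $\mathsf{ac}{\uparrow}\colon a\to(a\,.\,a)$; switch $(\alpha\,.\,[\beta\,.\,\gamma])\to[(\alpha\,.\,\beta)\,.\,\gamma]$; medial $[(\alpha\,.\,\beta)\,.\,(\gamma\,.\,\delta)]\to([\alpha\,.\,\gamma]\,.\,[\beta\,.\,\delta])$; and, in both directions, commutativity and associativity of both connectives and the equations $[\alpha\,.\,\mathsf f]=\alpha$, $(\alpha\,.\,\mathsf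 t)=\alpha$, $[\mathsf t\,.\,\mathsf t]=\mathsf t$, $(\mathsf f\,.\,\mathsf f)=\mathsf f$. **Flows.** An atomic flow is $(V,E,\eta,\mathit{up},\mathit{lo})$ with finite sets $V$ (vertices) and $E$ (edges), a labelling $\eta\colon V\to\{\mathsf{ai}{\downarrow},\mathsf{ai}{\uparrow},\mathsf{aw}{\downarrow},\mathsf{aw}{\uparrow},\mathsf{ac}{\downarrow},\mathsf{ac}{\uparrow}\}$ and maps $\mathit{up}\colon E\to V\cup\{\top\}$ and $\mathit{lo}\colon E\to V\cup\{\bot\}$. The lower (upper) edges of $\nu$ are the $\epsilon$ with $\mathit{up}(\epsilon)=\nu$ (with $\mathit{lo}(\epsilon)=\nu$); the upper (lower) edges of the flow are those with $\mathit{up}(\epsilon)=\top$ (with $\mathit{lo}(\epsilon)=\bot$). Vertices with the labels $\mathsf{ai}{\downarrow},\mathsf{ai}{\uparrow},\mathsf{aw}{\downarrow},\mathsf{aw}{\uparrow},\mathsf{ac}{\downarrow},\mathsf{ac}{\uparrow}$ have, respectively, $2,0,1,0,1,2$ lower and $0,2,0,1,2,1$ upper edges; the directed graph is acyclic; and there is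 a map $E\to\{-,+\}$ that is constant on the edges of each $\mathsf{ac}{\downarrow}$ or $\mathsf{ac}{\uparrow}$ vertex and takes both values on the edges of each $\mathsf{ai}{\downarrow}$ or $\mathsf{ai}{\uparrow}$ vertex. The flow associated with a derivation (unique up to isomorphism) has one vertex for each instance of an $\mathsf{ai}$, $\mathsf{aw}$ or $\mathsf{ac}$ rule, labelled by that rule; its edges trace the atom occurrences: occurrences in the premiss (conclusion) of such a rule instance are the upper (lower) edges of its vertex, all other rules and the contexts preserve edges, and the atom occurrences in the premiss and in the conclusion of the derivation are, one-to-one, its upper and its lower edges. **Paths.** A path is a non-empty sequence of adjacent edges that always goes down or always goes up; its ends lie in $V\cup\{\top,\bot\}$. An $\mathsf{ai}$-path is obtained by joining paths at $\mathsf{ai}{\downarrow}$ or $\mathsf{ai}{\uparrow}$ vertices, where the two edges adjacent at the junction are distinct. It is maximal if no $\mathsf{ai}$-path containing its edges is longer. An $\mathsf{ai}$-connection is a path between an $\mathsf{ai}{\downarrow}$ vertex and an $\mathsf{ai}{\uparrow}$ vertex, in either direction; a simple edge is an $\mathsf{ai}$-connection that consists of one edge. A clean path is an $\mathsf{ai}$-path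 in which every $\mathsf{ai}$-connection is a simple edge. An $\mathsf{ai}$-cycle is an $\mathsf{ai}$-path from a vertex in $V$ to itself in which no edge appears twice; it is fragile if it contains a simple edge. An extremal simple edge is a simple edge $\epsilon_k$ for which there is a clean path $\epsilon_1,\dots,\epsilon_k,\dots,\epsilon_h$ that is a maximal $\mathsf{ai}$-path and in which $\epsilon_{k+1},\dots,\epsilon_h$ are not simple edges. **Reductions.** The relations $\to_{\mathsf{bc}}$ and $\to_{\mathsf{ex}}$ between flows, together with a correspondence between the upper edges, and between the lower edges, of the two flows, are defined inductively, modulo isomorphism. Base cases: if $B$ has no fragile cycle, then $B\to_{\mathsf{bc}}B$; if $B$ has no extremal simple edge, then $B\to_{\mathsf{ex}}B$. Inductive case: let $\mathbf 1$ be a simple edge of $B$ from an $\mathsf{ai}{\downarrow}$ vertex $\nu$ to an $\mathsf{ai}{\uparrow}$ vertex $\nu'$, let $\mathbf 2$ be the other lower edge of $\nu$ and $\mathbf 3$ the other upper edge of $\nu'$ (possibly $\mathbf 2=\mathbf 3$). Let $B'$ be $B$ with $\mathbf 1$ and $\nu'$ erased and $\nu$ turned into an $\mathsf{aw}{\downarrow}$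 vertex, so that $\mathbf 3$ becomes a lower edge of the flow. Let $B''$ be $B$ with $\mathbf 1$ and $\nu$ erased and $\nu'$ turned into an $\mathsf{aw}{\uparrow}$ vertex, so that $\mathbf 2$ becomes an upper edge of the flow. For flows $D'$ and $D''$ whose upper and lower edges correspond to those of $B'$ and $B''$, let $C$ be obtained from the disjoint union of $D'$ and $D''$ by identifying the lower edge of $D'$ corresponding to $\mathbf 3$ with the upper edge of $D''$ corresponding to $\mathbf 2$, adding for each upper edge $\epsilon$ of $B$ an $\mathsf{ac}{\uparrow}$ vertex whose upper edge is a new upper edge of $C$ and whose lower edges are the upper edges of $D'$ and $D''$ corresponding to $\epsilon$, and adding for each lower edge $\epsilon'$ of $B$ an $\mathsf{ac}{\downarrow}$ vertex whose upper edges are the lower edges of $D'$ and $D''$ corresponding to $\epsilon'$ and whose lower edge is a new lower edge of $C$. The upper and lower edges of $C$ thus correspond to those of $B$. If $\mathbf 1$ belongs to an $\mathsf{ai}$-cycle, $B'\to_{\mathsf{bc}}D'$ and $B''\to_{\mathsf{bc}}D''$, then $B\to_{\mathsf{bc}}C$. If $\mathbf 1$ is an extremal simple edge, $B'\to_{\mathsf{ex}}D'$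 and $B''\to_{\mathsf{ex}}D''$, then $B\to_{\mathsf{ex}}C$. **Theorem.** The reductions $\to_{\mathsf{bc}}$ and $\to_{\mathsf{ex}}$ are sound: let $\to$ be either of them; for all flows $B$ and $C$ with $B\to C$ and every $\mathsf{SKS}$ derivation $\Phi$ with flow $B$, there is an $\mathsf{SKS}$ derivation with flow $C$ and with the same premiss and conclusion as $\Phi$. -/

import Mathlib

universe u

namespace AtomicFlows

/-! ## Formulae and derivations of system SKS -/

/-- A set of atoms: it carries an involution without fixed points. -/
class Atoms (X : Type u) where
  bar : X → X
  bar_bar : ∀ a, bar (bar a) = a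
  bar_ne : ∀ a, bar a ≠ a

/-- Formulae, freely built from the units, the atoms, disjunction and conjunction. -/
inductive Formula (X : Type u) : Type u
  | fls : Formula X
  | tru : Formula X
  | atom (a : X) : Formula X
  | or (α β : Formula X) : Formula X
  | and (α β : Formula X) : Formula X

/-- The atom occurrences of a formula. -/
def Formula.Occ {X : Type u} : Formula X → Type
  | .fls => Empty
  | .tru => Empty
  | .atom _ => Unit
  | .or α β => α.Occ ⊕ β.Occ
  | .and α β => α.Occ ⊕ β.Occ

open Formula in
/-- `Rule α β` is the type of rule instances of SKS with premiss `α` and conclusion `β`: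
the six atomic structural rules, switch, medial, and the two directions of each of the
equations that define the rule `=`. -/
inductive Rule {X : Type u} [Atoms X] : Formula X → Formula X → Type u
  | aiDown (a : X) : Rule tru (or (atom a) (atom (Atoms.bar a)))
  | aiUp (a : X) : Rule (and (atom a) (atom (Atoms.bar a))) fls
  | awDown (a : X) : Rule fls (atom a)
  | awUp (a : X) : Rule (atom a) tru
  | acDown (a : X) : Rule (or (atom a) (atom a)) (atom a)
  | acUp (a : X) : Rule (atom a) (and (atom a) (atom a))
  | switch (α β γ : Formula X) : Rule (and α (or β γ)) (or (and α β) γ)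
  | medial (α β γ δ : Formula X) :
      Rule (or (and α β) (and γ δ)) (and (or α γ) (or β δ))
  | orComm (α β : Formula X) : Rule (or α β) (or β α)
  | andComm (α β : Formula X) : Rule (and α β) (and β α)
  | orAssoc (α β γ : Formula X) : Rule (or (or α β) γ) (or α (or β γ))
  | orAssocInv (α β γ : Formula X) : Rule (or α (or β γ)) (or (or α β) γ)
  | andAssoc (α β γ : Formula X) : Rule (and (and α β) γ) (and α (and β γ))
  | andAssocInv (α β γ : Formula X) : Rule (and α (and β γ)) (and (and α β) γ)
  | orUnit (α : Formula X) : Rule (or α fls) α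
  | orUnitInv (α : Formula X) : Rule α (or α fls)
  | andUnit (α : Formula X) : Rule (and α tru) α
  | andUnitInv (α : Formula X) : Rule α (and α tru)
  | truTru : Rule (or tru tru) tru
  | truTruInv : Rule tru (or tru tru)
  | flsFls : Rule (and fls fls) fls
  | flsFlsInv : Rule fls (and fls fls)

/-- Inference steps: a rule instance applied inside an arbitrary context. -/
inductive Step {X : Type u} [Atoms X] : Formula X → Formula X → Type u
  | rule {α β : Formula X} (r : Rule α β) : Step α β
  | orLeft {α β : Formula X} (s : Step α β) (γ : Formula X) : Step (.or α γ) (.or β γ)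
  | orRight {α β : Formula X} (γ : Formula X) (s : Step α β) : Step (.or γ α) (.or γ β)
  | andLeft {α β : Formula X} (s : Step α β) (γ : Formula X) : Step (.and α γ) (.and β γ)
  | andRight {α β : Formula X} (γ : Formula X) (s : Step α β) : Step (.and γ α) (.and γ β)

/-- `Deriv α β` is the type of SKS derivations with premiss `α` and conclusion `β`:
finite chains of inference steps. -/
inductive Deriv {X : Type u} [Atoms X] : Formula X → Formula X → Type u
  | nil (α : Formula X) : Deriv α α
  | cons {α β γ : Formula X} (s : Step α β) (Φ : Deriv β γ) : Deriv α γ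

/-! ## Atomic flows -/

/-- The labels of the vertices of a flow: (co)interaction, (co)weakening, (co)contraction. -/
inductive Label
  | aiDown | aiUp | awDown | awUp | acDown | acUp

/-- The number of lower edges of a vertex with the given label. -/
def Label.lowerCard : Label → ℕ
  | .aiDown => 2
  | .aiUp => 0
  | .awDown => 1
  | .awUp => 0
  | .acDown => 1
  | .acUp => 2

/-- The number of upper edges of a vertex with the given label. -/
def Label.upperCard : Label → ℕ
  | .aiDown => 0
  | .aiUp => 2
  | .awDown => 0
  | .awUp => 1
  | .acDown => 2
  | .acUp => 1

/-- The tuple `(V, E, η, up, lo)`. The value `none` of `up` is the special vertex `⊤`, and the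
value `none` of `lo` is the special vertex `⊥`. -/
structure PreFlow where
  V : Type
  E : Type
  η : V → Label
  up : E → Option V
  lo : E → Option V

namespace PreFlow

/-- The set `L_ν` of lower edges of the vertex `ν`. -/
def lowerEdges (A : PreFlow) (ν : A.V) : Set A.E := {e | A.up e = some ν}

/-- The set `U_ν` of upper edges of the vertex `ν`. -/
def upperEdges (A : PreFlow) (ν : A.V) : Set A.E := {e | A.lo e = some ν}

/-- The set `E_ν` of edges of the vertex `ν`. -/
def edges (A : PreFlow) (ν : A.V) : Set A.E := A.lowerEdges ν ∪ A.upperEdges ν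

/-- The upper edges of the flow, that is, the lower edges of `⊤`. -/
abbrev Upper (A : PreFlow) : Type := {e : A.E // A.up e = none}

/-- The lower edges of the flow, that is, the upper edges of `⊥`. -/
abbrev Lower (A : PreFlow) : Type := {e : A.E // A.lo e = none}

/-- Edge `e` starts at the vertex where edge `e'` ends. -/
def Below (A : PreFlow) (e e' : A.E) : Prop := ∃ ν, A.up e = some ν ∧ A.lo e' = some ν

/-- Polarity assignments (`true` is the positive polarity). -/
def IsPolarity (A : PreFlow) (π : A.E → Bool) : Prop :=
  ∀ ν, ((A.η ν = .acDown ∨ A.η ν = .acUp) → π '' A.edges ν = {false} ∨ π '' A.edges ν = {true}) ∧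
    ((A.η ν = .aiDown ∨ A.η ν = .aiUp) → π '' A.edges ν = {false, true})

/-- Isomorphisms. -/
structure Iso (A B : PreFlow) where
  v : A.V ≃ B.V
  e : A.E ≃ B.E
  map_η : ∀ ν, B.η (v ν) = A.η ν
  map_up : ∀ x, B.up (e x) = (A.up x).map v
  map_lo : ∀ x, B.lo (e x) = (A.lo x).map v

end PreFlow

/-- Atomic flows. -/
structure Flow extends PreFlow where
  finite_V : Finite V
  finite_E : Finite E
  card_lower : ∀ ν, (toPreFlow.lowerEdges ν).ncard = (η ν).lowerCard
  card_upper : ∀ ν, (toPreFlow.upperEdges ν).ncard = (η ν).upperCard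
  acyclic : ∀ e, ¬ Relation.TransGen toPreFlow.Below e e
  polarity : ∃ π, toPreFlow.IsPolarity π

/-! ## The flow associated with a derivation -/

/-- `ν` is a vertex with label `k`, whose upper edges are listed without repetition by `l` and
whose lower edges are listed without repetition by `m`. -/
def PreFlow.VertexAt (A : PreFlow) (k : Label) (ν : A.V) {I J : Type} (l : I → A.E)
    (m : J → A.E) : Prop :=
  A.η ν = k ∧ Set.BijOn l Set.univ (A.upperEdges ν) ∧ Set.BijOn m Set.univ (A.lowerEdges ν)

/-- The atom occurrences in the premiss and in the conclusion of a rule instance are mapped to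
edges of `A` by `l` and `m`, as the rule prescribes: an instance of a structural rule is mapped
to a vertex with the corresponding label, and for an instance of a linear rule corresponding atom
occurrences are mapped to the same edges. The list `vs` contains the vertex, if there is one. -/
def Rule.Traces {X : Type u} [Atoms X] (A : PreFlow) : {α β : Formula X} → Rule α β →
    (α.Occ → A.E) → (β.Occ → A.E) → List A.V → Prop
  | _, _, .aiDown _, l, m, vs => ∃ ν, vs = [ν] ∧ A.VertexAt .aiDown ν l m
  | _, _, .aiUp _, l, m, vs => ∃ ν, vs = [ν] ∧ A.VertexAt .aiUp ν l m
  | _, _, .awDown _, l, m, vs => ∃ ν, vs = [ν] ∧ A.VertexAt .awDown ν l m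
  | _, _, .awUp _, l, m, vs => ∃ ν, vs = [ν] ∧ A.VertexAt .awUp ν l m
  | _, _, .acDown _, l, m, vs => ∃ ν, vs = [ν] ∧ A.VertexAt .acDown ν l m
  | _, _, .acUp _, l, m, vs => ∃ ν, vs = [ν] ∧ A.VertexAt .acUp ν l m
  | _, _, .switch α β γ, l, m, vs => vs = [] ∧
      ∃ (a : α.Occ → A.E) (b : β.Occ → A.E) (c : γ.Occ → A.E),
        l = Sum.elim a (Sum.elim b c) ∧ m = Sum.elim (Sum.elim a b) c
  | _, _, .medial α β γ δ, l, m, vs => vs = [] ∧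
      ∃ (a : α.Occ → A.E) (b : β.Occ → A.E) (c : γ.Occ → A.E) (d : δ.Occ → A.E),
        l = Sum.elim (Sum.elim a b) (Sum.elim c d) ∧
        m = Sum.elim (Sum.elim a c) (Sum.elim b d)
  | _, _, .orComm α β, l, m, vs => vs = [] ∧
      ∃ (a : α.Occ → A.E) (b : β.Occ → A.E), l = Sum.elim a b ∧ m = Sum.elim b a
  | _, _, .andComm α β, l, m, vs => vs = [] ∧
      ∃ (a : α.Occ → A.E) (b : β.Occ → A.E), l = Sum.elim a b ∧ m = Sum.elim b a
  | _, _, .orAssoc α β γ, l, m, vs => vs = [] ∧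
      ∃ (a : α.Occ → A.E) (b : β.Occ → A.E) (c : γ.Occ → A.E),
        l = Sum.elim (Sum.elim a b) c ∧ m = Sum.elim a (Sum.elim b c)
  | _, _, .orAssocInv α β γ, l, m, vs => vs = [] ∧
      ∃ (a : α.Occ → A.E) (b : β.Occ → A.E) (c : γ.Occ → A.E),
        l = Sum.elim a (Sum.elim b c) ∧ m = Sum.elim (Sum.elim a b) c
  | _, _, .andAssoc α β γ, l, m, vs => vs = [] ∧
      ∃ (a : α.Occ → A.E) (b : β.Occ → A.E) (c : γ.Occ → A.E),
        l = Sum.elim (Sum.elim a b) c ∧ m = Sum.elim a (Sum.elim b c)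
  | _, _, .andAssocInv α β γ, l, m, vs => vs = [] ∧
      ∃ (a : α.Occ → A.E) (b : β.Occ → A.E) (c : γ.Occ → A.E),
        l = Sum.elim a (Sum.elim b c) ∧ m = Sum.elim (Sum.elim a b) c
  | _, _, .orUnit α, l, m, vs => vs = [] ∧
      ∃ a : α.Occ → A.E, l = Sum.elim a Empty.elim ∧ m = a
  | _, _, .orUnitInv α, l, m, vs => vs = [] ∧
      ∃ a : α.Occ → A.E, l = a ∧ m = Sum.elim a Empty.elim
  | _, _, .andUnit α, l, m, vs => vs = [] ∧
      ∃ a : α.Occ → A.E, l = Sum.elim a Empty.elim ∧ m = a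
  | _, _, .andUnitInv α, l, m, vs => vs = [] ∧
      ∃ a : α.Occ → A.E, l = a ∧ m = Sum.elim a Empty.elim
  | _, _, .truTru, _, _, vs => vs = []
  | _, _, .truTruInv, _, _, vs => vs = []
  | _, _, .flsFls, _, _, vs => vs = []
  | _, _, .flsFlsInv, _, _, vs => vs = []

/-- The same for an inference step: the atom occurrences in the context are mapped to the same
edges in the premiss and in the conclusion. -/
def Step.Traces {X : Type u} [Atoms X] (A : PreFlow) : {α β : Formula X} → Step α β →
    (α.Occ → A.E) → (β.Occ → A.E) → List A.V → Prop
  | _, _, .rule r, l, m, vs => r.Traces A l m vs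
  | _, _, @Step.orLeft _ _ α β s γ, l, m, vs =>
      ∃ (a : α.Occ → A.E) (b : β.Occ → A.E) (c : γ.Occ → A.E),
        l = Sum.elim a c ∧ m = Sum.elim b c ∧ s.Traces A a b vs
  | _, _, @Step.orRight _ _ α β γ s, l, m, vs =>
      ∃ (a : α.Occ → A.E) (b : β.Occ → A.E) (c : γ.Occ → A.E),
        l = Sum.elim c a ∧ m = Sum.elim c b ∧ s.Traces A a b vs
  | _, _, @Step.andLeft _ _ α β s γ, l, m, vs =>
      ∃ (a : α.Occ → A.E) (b : β.Occ → A.E) (c : γ.Occ → A.E),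
        l = Sum.elim a c ∧ m = Sum.elim b c ∧ s.Traces A a b vs
  | _, _, @Step.andRight _ _ α β γ s, l, m, vs =>
      ∃ (a : α.Occ → A.E) (b : β.Occ → A.E) (c : γ.Occ → A.E),
        l = Sum.elim c a ∧ m = Sum.elim c b ∧ s.Traces A a b vs

/-- The atom occurrences of a derivation can be mapped to edges of `A` as the inference steps
prescribe, where `l` and `m` are the maps on the premiss and on the conclusion, and `vs` is the
list of the vertices of the instances of structural rules, from top to bottom. -/
def Deriv.Traces {X : Type u} [Atoms X] (A : PreFlow) : {α β : Formula X} → Deriv α β →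
    (α.Occ → A.E) → (β.Occ → A.E) → List A.V → Prop
  | _, _, .nil _, l, m, vs => l = m ∧ vs = []
  | _, _, @Deriv.cons _ _ _ β _ s Φ, l, m, vs =>
      ∃ (n : β.Occ → A.E) (vs₁ vs₂ : List A.V),
        s.Traces A l n vs₁ ∧ Φ.Traces A n m vs₂ ∧ vs = vs₁ ++ vs₂

/-- `A` is (up to isomorphism) the atomic flow associated with `Φ`: the atom occurrences of `Φ`
are mapped to the edges of `A` as the inference steps prescribe, the structural rule instances
correspond one-to-one to the vertices, the atom occurrences in the premiss one-to-one to the upper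
edges, and those in the conclusion one-to-one to the lower edges. Thus the map from the atom
occurrences of `Φ` to the edges is surjective, because every edge starts at a vertex or at `⊤`. -/
def Deriv.HasFlow {X : Type u} [Atoms X] {α β : Formula X} (Φ : Deriv α β) (A : Flow) : Prop :=
  ∃ (l : α.Occ → A.E) (m : β.Occ → A.E) (vs : List A.V),
    Φ.Traces A.toPreFlow l m vs ∧ vs.Nodup ∧ (∀ ν, ν ∈ vs) ∧
    Set.BijOn l Set.univ {e | A.up e = none} ∧ Set.BijOn m Set.univ {e | A.lo e = none}

/-- A reduction, that is, a relation between flows, is sound if every derivation whose flow is on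
the left-hand side can be replaced by a derivation with the flow on the right-hand side and the
same premiss and conclusion. -/
def Sound (X : Type u) [Atoms X] (R : Flow → Flow → Prop) : Prop :=
  ∀ A B : Flow, R A B → ∀ (α β : Formula X) (Φ : Deriv α β), Φ.HasFlow A →
    ∃ Ψ : Deriv α β, Ψ.HasFlow B

/-! ## Paths and cycles -/

/-- The set `V ∪ {⊤, ⊥}`. -/
inductive Node (V : Type)
  | top : Node V
  | bot : Node V
  | vertex (ν : V) : Node V

namespace PreFlow

variable (A : PreFlow)

/-- The upper end of an edge. -/
def upNode (e : A.E) : Node A.V := (A.up e).elim .top .vertex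

/-- The lower end of an edge. -/
def loNode (e : A.E) : Node A.V := (A.lo e).elim .bot .vertex

/-- The paths that go down. -/
inductive DownPath : Node A.V → List A.E → Node A.V → Prop
  | single (e : A.E) : DownPath (A.upNode e) [e] (A.loNode e)
  | cons (e : A.E) {p : List A.E} {y : Node A.V} (h : DownPath (A.loNode e) p y) :
      DownPath (A.upNode e) (e :: p) y

/-- Paths, which go down or go up. -/
def IsPath (x : Node A.V) (p : List A.E) (y : Node A.V) : Prop :=
  A.DownPath x p y ∨ A.DownPath y p.reverse x

/-- `ai`-paths: paths joined at interaction and cointeraction vertices, where the last edge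
before the vertex and the first edge after it are different. -/
inductive AiPath : Node A.V → List A.E → Node A.V → Prop
  | path {x y : Node A.V} {p : List A.E} (h : A.IsPath x p y) : AiPath x p y
  | join {x y : Node A.V} {p q : List A.E} (ν : A.V) (hν : A.η ν = .aiDown ∨ A.η ν = .aiUp)
      (hp : AiPath x p (.vertex ν)) (hq : AiPath (.vertex ν) q y)
      (hne : p.getLast? ≠ q.head?) : AiPath x (p ++ q) y

/-- The sequence of edges `p` is an `ai`-path. -/
def IsAiPath (p : List A.E) : Prop := ∃ x y, A.AiPath x p y

/-- An `ai`-path is maximal if no `ai`-path that contains its edges is longer. -/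
def IsMaximalAiPath (p : List A.E) : Prop :=
  A.IsAiPath p ∧ ∀ q, A.IsAiPath q → (∀ e ∈ p, e ∈ q) → q.length ≤ p.length

/-- `ai`-connections: paths from an interaction to a cointeraction vertex or vice versa. -/
def IsAiConnection (p : List A.E) : Prop :=
  ∃ ν ν' : A.V, A.IsPath (.vertex ν) p (.vertex ν') ∧
    (A.η ν = .aiDown ∧ A.η ν' = .aiUp ∨ A.η ν = .aiUp ∧ A.η ν' = .aiDown)

/-- Simple edges. -/
def IsSimpleEdge (e : A.E) : Prop := A.IsAiConnection [e]

/-- Clean paths: `ai`-paths in which every `ai`-connection is a simple edge. -/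
def IsCleanPath (p : List A.E) : Prop :=
  A.IsAiPath p ∧ ∀ c, c <:+: p → A.IsAiConnection c → ∃ e, c = [e]

/-- `ai`-cycles: `ai`-paths from a vertex (which is neither `⊤` nor `⊥`) to itself, where no edge
appears twice. -/
def IsAiCycle (p : List A.E) : Prop := (∃ ν, A.AiPath (.vertex ν) p (.vertex ν)) ∧ p.Nodup

/-- Fragile cycles: `ai`-cycles that contain a simple edge. -/
def IsFragileCycle (p : List A.E) : Prop := A.IsAiCycle p ∧ ∃ e ∈ p, A.IsSimpleEdge e

/-- Extremal simple edges: the last simple edge of a maximal clean path. -/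
def IsExtremal (e : A.E) : Prop :=
  ∃ p q : List A.E, A.IsCleanPath (p ++ e :: q) ∧ A.IsMaximalAiPath (p ++ e :: q) ∧
    A.IsSimpleEdge e ∧ ∀ e' ∈ q, ¬ A.IsSimpleEdge e'

end PreFlow

/-! ## The reductions -/

/-- Flows whose upper edges are named by the elements of `T` and whose lower edges are named by
the elements of `U`. -/
structure NamedFlow (T U : Type) extends Flow where
  top : T ≃ toFlow.Upper
  bot : U ≃ toFlow.Lower

/-- A simple edge `e₁` of a flow, from the interaction vertex `i` to the cointeraction vertex `j`,
together with the other lower edge `e₂` of `i` and the other upper edge `e₃` of `j`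
(possibly `e₂ = e₃`). -/
structure PreFlow.SimplePair (B : PreFlow) where
  i : B.V
  j : B.V
  e₁ : B.E
  e₂ : B.E
  e₃ : B.E
  η_i : B.η i = .aiDown
  η_j : B.η j = .aiUp
  up_e₁ : B.up e₁ = some i
  lo_e₁ : B.lo e₁ = some j
  up_e₂ : B.up e₂ = some i
  lo_e₃ : B.lo e₃ = some j
  e₂_ne : e₂ ≠ e₁
  e₃_ne : e₃ ≠ e₁

open Classical in
/-- The result of erasing the edge `e`, erasing the vertex `d`, so that `d` becomes `⊤` or `⊥`
for the other edges at `d`, and giving the label `k` to the vertex `w`. -/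
noncomputable def PreFlow.erase (B : PreFlow) (e : B.E) (d w : B.V) (k : Label) : PreFlow where
  V := {ν : B.V // ν ≠ d}
  E := {x : B.E // x ≠ e}
  η ν := if ν.1 = w then k else B.η ν.1
  up x := (B.up x.1).bind fun ν => if h : ν ≠ d then some ⟨ν, h⟩ else none
  lo x := (B.lo x.1).bind fun ν => if h : ν ≠ d then some ⟨ν, h⟩ else none

/-- `B'` is obtained from `B` by erasing `e₁` and the cointeraction `j` and by replacing the
interaction `i` with a weakening; its new lower edge `e₃` gets the name `none`. -/
def IsWeakened {T U : Type} (B : NamedFlow T U) (s : B.SimplePair)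
    (B' : NamedFlow T (Option U)) : Prop :=
  ∃ φ : PreFlow.Iso B'.toPreFlow (B.erase s.e₁ s.j s.i .awDown),
    (∀ t, (φ.e (B'.top t).1).1 = (B.top t).1) ∧
    (∀ u, (φ.e (B'.bot (some u)).1).1 = (B.bot u).1) ∧ (φ.e (B'.bot none).1).1 = s.e₃

/-- `B''` is obtained from `B` by erasing `e₁` and the interaction `i` and by replacing the
cointeraction `j` with a coweakening; its new upper edge `e₂` gets the name `none`. -/
def IsCoweakened {T U : Type} (B : NamedFlow T U) (s : B.SimplePair)
    (B'' : NamedFlow (Option T) U) : Prop :=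
  ∃ φ : PreFlow.Iso B''.toPreFlow (B.erase s.e₁ s.i s.j .awUp),
    (∀ t, (φ.e (B''.top (some t)).1).1 = (B.top t).1) ∧ (φ.e (B''.top none).1).1 = s.e₂ ∧
    (∀ u, (φ.e (B''.bot u).1).1 = (B.bot u).1)

section Compose

variable {T U : Type} (D' : NamedFlow T (Option U)) (D'' : NamedFlow (Option T) U)

/-- The vertices of the composition of `D'` and `D''`: a cocontraction for each `t : T`, a
contraction for each `u : U`, and the vertices of `D'` and `D''`. -/
inductive ComposeV
  | cocontraction (t : T)
  | contraction (u : U)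
  | fst (ν : D'.V)
  | snd (ν : D''.V)

/-- The edges of the composition: an upper edge for each `t : T`, a lower edge for each `u : U`,
and the edges of `D'` and `D''`, where the upper edge of `D''` named `none` is left out, because it
is identified with the lower edge of `D'` named `none`. -/
inductive ComposeE
  | upper (t : T)
  | lower (u : U)
  | fst (e : D'.E)
  | snd (e : D''.E) (h : e ≠ (D''.top none).1)

/-- The upper end, in the composition, of an edge of `D'`. -/
def upFst (e : D'.E) : Option (ComposeV D' D'') :=
  match h : D'.up e with
  | some ν => some (.fst ν)
  | none => some (.cocontraction (D'.top.symm ⟨e, h⟩))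

/-- The upper end, in the composition, of an edge of `D''` that is not the upper edge named
`none`. -/
def upSnd (e : D''.E) : Option (ComposeV D' D'') :=
  match h : D''.up e with
  | some ν => some (.snd ν)
  | none => (D''.top.symm ⟨e, h⟩).map .cocontraction

/-- The lower end, in the composition, of an edge of `D''`. -/
def loSnd (e : D''.E) : Option (ComposeV D' D'') :=
  match h : D''.lo e with
  | some ν => some (.snd ν)
  | none => some (.contraction (D''.bot.symm ⟨e, h⟩))

/-- The lower end, in the composition, of an edge of `D'`; the lower edge of `D'` named `none`
continues as the upper edge of `D''` named `none`. -/
def loFst (e : D'.E) : Option (ComposeV D' D'') :=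
  match h : D'.lo e with
  | some ν => some (.fst ν)
  | none =>
    match D'.bot.symm ⟨e, h⟩ with
    | some u => some (.contraction u)
    | none => loSnd D' D'' (D''.top none).1

/-- The composition of `D'` and `D''`: the upper edges of `D'` and `D''` with the same name `t` are
the lower edges of a cocontraction, their lower edges with the same name `u` are the upper edges of
a contraction, and the lower edge of `D'` named `none` is identified with the upper edge of `D''`
named `none`. -/
def compose : PreFlow where
  V := ComposeV D' D''
  E := ComposeE D' D''
  η
    | .cocontraction _ => .acUp
    | .contraction _ => .acDown
    | .fst ν => D'.η ν
    | .snd ν => D''.η ν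
  up
    | .upper _ => none
    | .lower u => some (.contraction u)
    | .fst e => upFst D' D'' e
    | .snd e _ => upSnd D' D'' e
  lo
    | .upper t => some (.cocontraction t)
    | .lower _ => none
    | .fst e => loFst D' D'' e
    | .snd e _ => loSnd D' D'' e

end Compose

/-- The recursion scheme shared by the two reductions, on flows with named upper and lower edges
and modulo isomorphisms that respect the names: if `halt B`, then `B` reduces to itself; if
`select B e₁` for a simple edge `e₁`, and `B'` and `B''` (see `IsWeakened`, `IsCoweakened`) reduce
to `D'` and `D''`, then `B` reduces to the composition of `D'` and `D''`. -/
inductive Reduces (halt : PreFlow → Prop) (select : (B : PreFlow) → B.E → Prop) :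
    {T U : Type} → NamedFlow T U → NamedFlow T U → Prop
  | base {T U : Type} {B C : NamedFlow T U} (φ : PreFlow.Iso C.toPreFlow B.toPreFlow)
      (htop : ∀ t, φ.e (C.top t).1 = (B.top t).1) (hbot : ∀ u, φ.e (C.bot u).1 = (B.bot u).1)
      (hhalt : halt B.toPreFlow) : Reduces halt select B C
  | step {T U : Type} {B C : NamedFlow T U} (s : B.SimplePair)
      (hselect : select B.toPreFlow s.e₁)
      {B' D' : NamedFlow T (Option U)} {B'' D'' : NamedFlow (Option T) U}
      (hB' : IsWeakened B s B') (hB'' : IsCoweakened B s B'')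
      (hD' : Reduces halt select B' D') (hD'' : Reduces halt select B'' D'')
      (φ : PreFlow.Iso C.toPreFlow (compose D' D''))
      (htop : ∀ t, φ.e (C.top t).1 = .upper t) (hbot : ∀ u, φ.e (C.bot u).1 = .lower u) :
      Reduces halt select B C

/-- The relation between flows that `Reduces` induces; the upper and lower edges of `B` serve as
names for the corresponding upper and lower edges of `B` and `C`. -/
def ReducesTo (halt : PreFlow → Prop) (select : (B : PreFlow) → B.E → Prop) (B C : Flow) : Prop :=
  ∃ (top : B.Upper ≃ C.Upper) (bot : B.Lower ≃ C.Lower),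
    Reduces halt select ⟨B, Equiv.refl _, Equiv.refl _⟩ ⟨C, top, bot⟩

/-- The reduction `bc` (break `ai`-cycles). -/
def BC : Flow → Flow → Prop :=
  ReducesTo (fun B => ¬ ∃ p, B.IsFragileCycle p) (fun B e => ∃ p, B.IsAiCycle p ∧ e ∈ p)

/-- The reduction `ex` (eliminate extremal simple edges). -/
def EX : Flow → Flow → Prop :=
  ReducesTo (fun B => ¬ ∃ e, B.IsExtremal e) (fun B e => B.IsExtremal e)

end AtomicFlows

/-!
Both reductions are instances of one recursion scheme, which is sound for every choice of the simple
edges and of the condition for stopping. The proof is by induction on the recursion.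

Let `Φ` be a derivation of `β` from `α` with flow `B`, and let `e₁` be a simple edge from the
interaction `i` to the cointeraction `j`, carrying the atom `a`. The other edges `e₂` of `i` and
`e₃` of `j` then carry `ā`. Replace all occurrences of `e₁` in `Φ` with `t`. The step at `i` becomes
`t = [t . f] → [t . ā]`, with a weakening, and the premiss `(t . ā)` of the step at `j` is `ā`,
which is pulled out of its context by switches. This yields a derivation of `[β . ā]` from `α`,
whose flow is `B'` (`PreFlow.SimplePair.realizes_weakened`). Dually, replacing `e₁` with `f` yields
a derivation of `β` from `(α . ā)` whose flow is `B''` (`PreFlow.SimplePair.realizes_coweakened`).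
By induction there are derivations with the same premisses and conclusions and with the flows `D'`
and `D''`, and
`α → (α . α) → (α . [β . ā]) → [β . (α . ā)] → [β . β] → β`
has the composition of `D'` and `D''` as its flow (`realizes_compose`); the first and the last part
are cocontractions and contractions, reduced to atomic ones by medial.

The substitutions are carried out on formulae whose atoms are the edges of the flow, where the atoms
of the original formulae are kept as a labelling of the edges. `Deduces` is the calculus for such
formulae. To pass from a derivation to it, one has to know that all occurrences of an edge carry
the same atom (`Deduces.exists_labelling`); the way back is `Deduces.exists_deriv`.
-/

namespace AtomicFlows

/-! ### Formulae over a set of edges -/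

namespace Formula

variable {E : Type*} {E' : Type*} {E'' : Type*}

/-- Simultaneous substitution of formulae for atoms. -/
def bind : Formula E → (E → Formula E') → Formula E'
  | fls, _ => fls
  | tru, _ => tru
  | atom e, σ => σ e
  | or F G, σ => or (F.bind σ) (G.bind σ)
  | and F G, σ => and (F.bind σ) (G.bind σ)

/-- Renaming of atoms. -/
def map (F : Formula E) (g : E → E') : Formula E' := F.bind fun e => atom (g e)

/-- The list of the atom occurrences, from left to right. -/
def atoms : Formula E → List E
  | fls => []
  | tru => []
  | atom e => [e]
  | or F G => F.atoms ++ G.atoms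
  | and F G => F.atoms ++ G.atoms

/-- The elements of `S` occur exactly once in `F`, and nothing else occurs in `F`. -/
def Enumerates (F : Formula E) (S : Set E) : Prop :=
  F.atoms.Nodup ∧ ∀ e, e ∈ F.atoms ↔ e ∈ S

@[simp] theorem map_fls (g : E → E') : (fls : Formula E).map g = fls := rfl
@[simp] theorem map_tru (g : E → E') : (tru : Formula E).map g = tru := rfl
@[simp] theorem map_atom (g : E → E') (e : E) : (atom e).map g = atom (g e) := rfl
@[simp] theorem map_or (g : E → E') (F G : Formula E) :
    (or F G).map g = or (F.map g) (G.map g) := rfl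
@[simp] theorem map_and (g : E → E') (F G : Formula E) :
    (and F G).map g = and (F.map g) (G.map g) := rfl

theorem bind_congr {F : Formula E} {σ τ : E → Formula E'} (h : ∀ e ∈ F.atoms, σ e = τ e) :
    F.bind σ = F.bind τ := by
  induction F with
  | fls => rfl
  | tru => rfl
  | atom e => exact h e (by simp [atoms])
  | or F G hF hG | and F G hF hG =>
    simp only [atoms, List.mem_append] at h
    simp only [bind, hF fun e he => h e (.inl he), hG fun e he => h e (.inr he)]

theorem map_congr {F : Formula E} {f g : E → E'} (h : ∀ e ∈ F.atoms, f e = g e) :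
    F.map f = F.map g :=
  bind_congr fun e he => by rw [h e he]

theorem bind_bind (F : Formula E) (σ : E → Formula E') (τ : E' → Formula E'') :
    (F.bind σ).bind τ = F.bind fun e => (σ e).bind τ := by
  induction F <;> simp_all [bind]

theorem bind_map (F : Formula E) (g : E → E') (τ : E' → Formula E'') :
    (F.map g).bind τ = F.bind fun e => τ (g e) :=
  bind_bind ..

@[simp] theorem map_map (F : Formula E) (f : E → E') (g : E' → E'') :
    (F.map f).map g = F.map fun e => g (f e) :=
  bind_bind ..

@[simp] theorem map_id (F : Formula E) : (F.map fun e => e) = F := by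
  induction F <;> simp_all

@[simp] theorem atoms_map (F : Formula E) (g : E → E') : (F.map g).atoms = F.atoms.map g := by
  induction F <;> simp_all [atoms]

theorem Enumerates.map {F : Formula E} {S : Set E} (h : F.Enumerates S) {g : E → E'}
    (hg : Set.InjOn g S) : (F.map g).Enumerates (g '' S) := by
  refine ⟨?_, fun e => ?_⟩
  · rw [atoms_map]
    exact h.1.map_on fun a ha b hb hab => hg ((h.2 a).1 ha) ((h.2 b).1 hb) hab
  · simp [atoms_map, h.2]

/-- A formula over `E` whose atoms lie in `S` is a formula over `S`. -/
theorem exists_map_val {S : Set E} (F : Formula E) (h : ∀ e ∈ F.atoms, e ∈ S) :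
    ∃ P : Formula S, P.map Subtype.val = F := by
  induction F with
  | fls => exact ⟨fls, rfl⟩
  | tru => exact ⟨tru, rfl⟩
  | atom e => exact ⟨atom ⟨e, h e (by simp [atoms])⟩, rfl⟩
  | or F G hF hG =>
    simp only [atoms, List.mem_append] at h
    obtain ⟨P, rfl⟩ := hF fun e he => h e (.inl he)
    obtain ⟨Q, rfl⟩ := hG fun e he => h e (.inr he)
    exact ⟨or P Q, rfl⟩
  | and F G hF hG =>
    simp only [atoms, List.mem_append] at h
    obtain ⟨P, rfl⟩ := hF fun e he => h e (.inl he)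
    obtain ⟨Q, rfl⟩ := hG fun e he => h e (.inr he)
    exact ⟨and P Q, rfl⟩

/-- The linear rules of SKS, that is, all rules but the atomic structural ones. -/
inductive Lin : Formula E → Formula E → Prop
  | switch (α β γ : Formula E) : Lin (and α (or β γ)) (or (and α β) γ)
  | medial (α β γ δ : Formula E) :
      Lin (or (and α β) (and γ δ)) (and (or α γ) (or β δ))
  | orComm (α β : Formula E) : Lin (or α β) (or β α)
  | andComm (α β : Formula E) : Lin (and α β) (and β α)
  | orAssoc (α β γ : Formula E) : Lin (or (or α β) γ) (or α (or β γ))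
  | orAssocInv (α β γ : Formula E) : Lin (or α (or β γ)) (or (or α β) γ)
  | andAssoc (α β γ : Formula E) : Lin (and (and α β) γ) (and α (and β γ))
  | andAssocInv (α β γ : Formula E) : Lin (and α (and β γ)) (and (and α β) γ)
  | orUnit (α : Formula E) : Lin (or α fls) α
  | orUnitInv (α : Formula E) : Lin α (or α fls)
  | andUnit (α : Formula E) : Lin (and α tru) α
  | andUnitInv (α : Formula E) : Lin α (and α tru)
  | truTru : Lin (or tru tru) tru
  | truTruInv : Lin tru (or tru tru)
  | flsFls : Lin (and fls fls) fls
  | flsFlsInv : Lin fls (and fls fls)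

theorem Lin.bind {F G : Formula E} (h : Lin F G) (σ : E → Formula E') :
    Lin (F.bind σ) (G.bind σ) := by
  cases h <;> constructor

theorem Lin.mem_atoms {F G : Formula E} (h : Lin F G) {e : E} (he : e ∈ G.atoms) :
    e ∈ F.atoms := by
  cases h <;> simp only [atoms, List.mem_append, List.not_mem_nil] at he ⊢ <;> tauto

end Formula

/-! ### Deductions on edge formulae -/

open Formula

/-- `Deduces R F G vs`: the formula `G` is obtained from `F` by linear rules and by the steps that
`R` allows at the vertices `vs`, listed in the order of their use. Unlike in `Deriv`, whole
deductions may be put into a context. -/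
inductive Deduces {V : Type*} {E : Type*} (R : V → Formula E → Formula E → Prop) :
    Formula E → Formula E → List V → Prop
  | lin {F G : Formula E} (h : Lin F G) : Deduces R F G []
  | vertex {F G : Formula E} (ν : V) (h : R ν F G) : Deduces R F G [ν]
  | refl (F : Formula E) : Deduces R F F []
  | trans {F G H : Formula E} {vs ws : List V} (h₁ : Deduces R F G vs) (h₂ : Deduces R G H ws) :
      Deduces R F H (vs ++ ws)
  | orLeft {F G : Formula E} {vs : List V} (h : Deduces R F G vs) (H : Formula E) :
      Deduces R (.or F H) (.or G H) vs
  | orRight {F G : Formula E} {vs : List V} (H : Formula E) (h : Deduces R F G vs) :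
      Deduces R (.or H F) (.or H G) vs
  | andLeft {F G : Formula E} {vs : List V} (h : Deduces R F G vs) (H : Formula E) :
      Deduces R (.and F H) (.and G H) vs
  | andRight {F G : Formula E} {vs : List V} (H : Formula E) (h : Deduces R F G vs) :
      Deduces R (.and H F) (.and H G) vs

namespace Deduces

variable {V : Type*} {E : Type*} {V' : Type*} {E' : Type*}
variable {R : V → Formula E → Formula E → Prop} {R' : V' → Formula E' → Formula E' → Prop}

theorem nil_trans {F G H : Formula E} {vs : List V} (h₁ : Deduces R F G [])
    (h₂ : Deduces R G H vs) : Deduces R F H vs :=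
  h₁.trans h₂

theorem trans_nil {F G H : Formula E} {vs : List V} (h₁ : Deduces R F G vs)
    (h₂ : Deduces R G H []) : Deduces R F H vs := by
  simpa using h₁.trans h₂

theorem exists_of_mem {F G : Formula E} {vs : List V} (h : Deduces R F G vs) {ν : V}
    (hν : ν ∈ vs) : ∃ F' G', R ν F' G' := by
  induction h with
  | lin | refl => simp at hν
  | vertex ν' h => obtain rfl := List.mem_singleton.1 hν; exact ⟨_, _, h⟩
  | trans _ _ ih₁ ih₂ => exact (List.mem_append.1 hν).elim ih₁ ih₂
  | orLeft _ _ ih | orRight _ _ ih | andLeft _ _ ih | andRight _ _ ih => exact ih hν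

/-- Deductions are closed under substitution. Vertices `ν` with `f ν = none` disappear. -/
theorem bind {F G : Formula E} {vs : List V} (h : Deduces R F G vs) (σ : E → Formula E')
    (f : V → Option V')
    (hR : ∀ ν ∈ vs, ∀ F G, R ν F G → Deduces R' (F.bind σ) (G.bind σ) (f ν).toList) :
    Deduces R' (F.bind σ) (G.bind σ) (vs.filterMap f) := by
  induction h with
  | lin h => exact .lin (h.bind σ)
  | refl => exact .refl _
  | vertex ν h =>
    have := hR ν (by simp) _ _ h
    cases hf : f ν <;> simpa [hf] using this
  | trans _ _ ih₁ ih₂ =>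
    rw [List.filterMap_append]
    exact (ih₁ fun ν hν => hR ν (by simp [hν])).trans (ih₂ fun ν hν => hR ν (by simp [hν]))
  | orLeft _ _ ih => exact (ih hR).orLeft _
  | orRight _ _ ih => exact (ih hR).orRight _
  | andLeft _ _ ih => exact (ih hR).andLeft _
  | andRight _ _ ih => exact (ih hR).andRight _

theorem map {F G : Formula E} {vs : List V} (h : Deduces R F G vs) (g : E → E') (f : V → V')
    (hR : ∀ ν F G, R ν F G → R' (f ν) (F.map g) (G.map g)) :
    Deduces R' (F.map g) (G.map g) (vs.map f) := by
  have := h.bind (R' := R') (fun e => .atom (g e)) (fun ν => some (f ν))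
    fun ν _ F G h => .vertex _ (hR ν F G h)
  rwa [← List.filterMap_eq_map']

/-- If the substitution turns the step at `j`, which is used once, into a step that produces an
additional disjunct `c`, then `c` can be pulled out of the context by switch. -/
theorem bind_or {F G : Formula E} {vs : List V} (h : Deduces R F G vs) (σ : E → Formula E')
    (f : V → Option V') (j : V) (c : Formula E')
    (hR : ∀ ν, ν ≠ j → ∀ F G, R ν F G → Deduces R' (F.bind σ) (G.bind σ) (f ν).toList)
    (hj : ∀ F G, R j F G → Deduces R' (F.bind σ) (.or (G.bind σ) c) (f j).toList)
    (hvs : vs.Nodup) (hmem : j ∈ vs) :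
    Deduces R' (F.bind σ) (.or (G.bind σ) c) (vs.filterMap f) := by
  have orSwap : ∀ G H : Formula E',
      Deduces R' (.or (.or G c) H) (.or (.or G H) c) [] := fun G H =>
    .nil_trans (.lin (.orAssoc ..)) <| .nil_trans (.orRight _ (.lin (.orComm ..))) <|
      .lin (.orAssocInv ..)
  have andSwap : ∀ G H : Formula E',
      Deduces R' (.and H (.or G c)) (.or (.and H G) c) [] := fun G H =>
    .lin (.switch ..)
  induction h with
  | lin h | refl => simp at hmem
  | vertex ν h =>
    obtain rfl := List.mem_singleton.1 hmem
    have := hj _ _ h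
    cases hf : f j <;> simpa [hf] using this
  | trans h₁ h₂ ih₁ ih₂ =>
    rw [List.filterMap_append]
    obtain ⟨hvs₁, hvs₂, hd⟩ := List.nodup_append.1 hvs
    rcases List.mem_append.1 hmem with hm | hm
    · exact (ih₁ hvs₁ hm).trans (.orLeft (h₂.bind σ f fun ν hν => hR ν
        fun h => hd _ hm _ hν h.symm) _)
    · exact (h₁.bind σ f fun ν hν => hR ν fun h => hd _ hν _ hm h).trans (ih₂ hvs₂ hm)
  | orLeft _ H ih => exact ((ih hvs hmem).orLeft _).trans_nil (orSwap ..)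
  | orRight H _ ih => exact ((ih hvs hmem).orRight _).trans_nil (.lin (.orAssocInv ..))
  | andLeft _ H ih =>
    exact ((ih hvs hmem).andLeft _).trans_nil <| .nil_trans (.lin (.andComm ..)) <|
      .nil_trans (andSwap ..) (.orLeft (.lin (.andComm ..)) _)
  | andRight H _ ih => exact ((ih hvs hmem).andRight _).trans_nil (andSwap ..)

/-- The dual of `bind_or`: if the step at `i` needs an additional conjunct `c`, then `c` can be
supplied in the premiss and pushed into the context by switch. -/
theorem bind_and {F G : Formula E} {vs : List V} (h : Deduces R F G vs) (σ : E → Formula E')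
    (f : V → Option V') (i : V) (c : Formula E')
    (hR : ∀ ν, ν ≠ i → ∀ F G, R ν F G → Deduces R' (F.bind σ) (G.bind σ) (f ν).toList)
    (hi : ∀ F G, R i F G → Deduces R' (.and (F.bind σ) c) (G.bind σ) (f i).toList)
    (hvs : vs.Nodup) (hmem : i ∈ vs) :
    Deduces R' (.and (F.bind σ) c) (G.bind σ) (vs.filterMap f) := by
  have orSwap : ∀ F H : Formula E',
      Deduces R' (.and (.or F H) c) (.or (.and F c) H) [] := fun F H =>
    .nil_trans (.lin (.andComm ..)) <| .nil_trans (.lin (.switch ..)) <|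
      .orLeft (.lin (.andComm ..)) _
  induction h with
  | lin h | refl => simp at hmem
  | vertex ν h =>
    obtain rfl := List.mem_singleton.1 hmem
    have := hi _ _ h
    cases hf : f i <;> simpa [hf] using this
  | trans h₁ h₂ ih₁ ih₂ =>
    rw [List.filterMap_append]
    obtain ⟨hvs₁, hvs₂, hd⟩ := List.nodup_append.1 hvs
    rcases List.mem_append.1 hmem with hm | hm
    · exact (ih₁ hvs₁ hm).trans (h₂.bind σ f fun ν hν => hR ν fun h => hd _ hm _ hν h.symm)
    · exact .trans (.andLeft (h₁.bind σ f fun ν hν => hR ν fun h => hd _ hν _ hm h) _)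
        (ih₂ hvs₂ hm)
  | orLeft _ H ih => exact .nil_trans (orSwap ..) ((ih hvs hmem).orLeft _)
  | orRight H _ ih =>
    exact .nil_trans (.andLeft (.lin (.orComm ..)) _) <| .nil_trans (orSwap ..) <|
      .nil_trans (.lin (.orComm ..)) ((ih hvs hmem).orRight _)
  | andLeft _ H ih =>
    exact .nil_trans (.lin (.andAssoc ..)) <| .nil_trans (.andRight _ (.lin (.andComm ..))) <|
      .nil_trans (.lin (.andAssocInv ..)) ((ih hvs hmem).andLeft _)
  | andRight H _ ih => exact .nil_trans (.lin (.andAssoc ..)) ((ih hvs hmem).andRight _)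

theorem contraction {T : Type*} (P : Formula T) (a b c : T → E) (f : T → V)
    (h : ∀ t, R (f t) (.or (.atom (a t)) (.atom (b t))) (.atom (c t))) :
    Deduces R (.or (P.map a) (P.map b)) (P.map c) (P.atoms.map f) := by
  induction P with
  | fls => exact .lin (.orUnit _)
  | tru => exact .lin .truTru
  | atom t => exact .vertex _ (h t)
  | or P Q hP hQ =>
    have swap : Deduces R (.or (.or (P.map a) (Q.map a)) (.or (P.map b) (Q.map b)))
        (.or (.or (P.map a) (P.map b)) (.or (Q.map a) (Q.map b))) [] :=
      .nil_trans (.lin (.orAssoc ..)) <| .nil_trans (.orRight _ <|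
        .nil_trans (.lin (.orAssocInv ..)) <| .nil_trans (.orLeft (.lin (.orComm ..)) _) <|
        .lin (.orAssoc ..)) <| .lin (.orAssocInv ..)
    simpa [atoms] using swap.nil_trans ((hP.orLeft _).trans (hQ.orRight _))
  | and P Q hP hQ =>
    simpa [atoms] using nil_trans (.lin (.medial ..)) ((hP.andLeft _).trans (hQ.andRight _))

theorem cocontraction {T : Type*} (P : Formula T) (a b c : T → E) (f : T → V)
    (h : ∀ t, R (f t) (.atom (c t)) (.and (.atom (a t)) (.atom (b t)))) :
    Deduces R (P.map c) (.and (P.map a) (P.map b)) (P.atoms.map f) := by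
  induction P with
  | fls => exact .lin .flsFlsInv
  | tru => exact .lin (.andUnitInv _)
  | atom t => exact .vertex _ (h t)
  | or P Q hP hQ =>
    simpa [atoms] using trans_nil ((hP.orLeft _).trans (hQ.orRight _)) (.lin (.medial ..))
  | and P Q hP hQ =>
    have swap : Deduces R (.and (.and (P.map a) (P.map b)) (.and (Q.map a) (Q.map b)))
        (.and (.and (P.map a) (Q.map a)) (.and (P.map b) (Q.map b))) [] :=
      .nil_trans (.lin (.andAssoc ..)) <| .nil_trans (.andRight _ <|
        .nil_trans (.lin (.andAssocInv ..)) <| .nil_trans (.andLeft (.lin (.andComm ..)) _) <|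
        .lin (.andAssoc ..)) <| .lin (.andAssocInv ..)
    simpa [atoms] using trans_nil ((hP.andLeft _).trans (hQ.andRight _)) swap

end Deduces

/-! ### Labelled vertex steps -/

section Shape

variable {X : Type u} [Atoms X] {E : Type*} {E' : Type*}

/-- The premiss and the conclusion of an atomic structural rule, on edges labelled by `x`. -/
inductive Shape (x : E → X) : Label → Formula E → Formula E → Prop
  | aiDown (e e' : E) (h : x e' = Atoms.bar (x e)) :
      Shape x .aiDown .tru (.or (.atom e) (.atom e'))
  | aiUp (e e' : E) (h : x e' = Atoms.bar (x e)) :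
      Shape x .aiUp (.and (.atom e) (.atom e')) .fls
  | awDown (e : E) : Shape x .awDown .fls (.atom e)
  | awUp (e : E) : Shape x .awUp (.atom e) .tru
  | acDown (e₁ e₂ e : E) (h₁ : x e₁ = x e) (h₂ : x e₂ = x e) :
      Shape x .acDown (.or (.atom e₁) (.atom e₂)) (.atom e)
  | acUp (e₁ e₂ e : E) (h₁ : x e₁ = x e) (h₂ : x e₂ = x e) :
      Shape x .acUp (.atom e) (.and (.atom e₁) (.atom e₂))

theorem Shape.map {x : E → X} {k : Label} {F G : Formula E} (h : Shape x k F G) {x' : E' → X}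
    {g : E → E'} (hF : ∀ e ∈ F.atoms, x' (g e) = x e) (hG : ∀ e ∈ G.atoms, x' (g e) = x e) :
    Shape x' k (F.map g) (G.map g) := by
  cases h <;> simp only [atoms, List.mem_append, List.mem_singleton, List.not_mem_nil,
      forall_eq_or_imp, forall_eq]
    at hF hG <;> simp only [map_fls, map_tru, map_atom, map_or, map_and] <;>
    constructor <;> simp_all

namespace PreFlow

variable (A : PreFlow)

/-- `F` to `G` is an instance of the atomic structural rule at the vertex `ν`, where `x` gives the
atoms on the edges. -/
structure Inst (x : A.E → X) (ν : A.V) (F G : Formula A.E) : Prop where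
  shape : Shape x (A.η ν) F G
  upper : F.Enumerates (A.upperEdges ν)
  lower : G.Enumerates (A.lowerEdges ν)

/-- The same for formulae whose occurrences carry both an atom and an edge, so that different
occurrences of an edge may carry different atoms. -/
structure PairInst (ν : A.V) (F G : Formula (X × A.E)) : Prop where
  shape : Shape Prod.fst (A.η ν) F G
  upper : (F.map Prod.snd).Enumerates (A.upperEdges ν)
  lower : (G.map Prod.snd).Enumerates (A.lowerEdges ν)

/-- `F` to `G` is a deduction that uses each vertex of `A` exactly once, where `x` gives the atoms
on the edges. -/
def Realizes (x : A.E → X) (F G : Formula A.E) : Prop :=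
  ∃ vs : List A.V, Deduces (A.Inst x) F G vs ∧ vs.Nodup ∧ ∀ ν, ν ∈ vs

variable {A}

theorem Inst.map {A' : PreFlow} {x : A.E → X} {x' : A'.E → X} {ν : A.V} {ν' : A'.V}
    {F G : Formula A.E} (h : A.Inst x ν F G) {g : A.E → A'.E} (hη : A'.η ν' = A.η ν)
    (hU : A'.upperEdges ν' = g '' A.upperEdges ν) (hL : A'.lowerEdges ν' = g '' A.lowerEdges ν)
    (hgU : Set.InjOn g (A.upperEdges ν)) (hgL : Set.InjOn g (A.lowerEdges ν))
    (hxU : ∀ e ∈ A.upperEdges ν, x' (g e) = x e) (hxL : ∀ e ∈ A.lowerEdges ν, x' (g e) = x e) :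
    A'.Inst x' ν' (F.map g) (G.map g) where
  shape := hη ▸ h.shape.map (fun e he => hxU e ((h.upper.2 e).1 he))
    fun e he => hxL e ((h.lower.2 e).1 he)
  upper := hU ▸ h.upper.map hgU
  lower := hL ▸ h.lower.map hgL

end PreFlow

end Shape

/-! ### From derivations to deductions -/

section Traces

variable {X : Type u}

/-- The formula `α` where the edges given by `l` are added to the atom occurrences. -/
def pairs {E : Type*} : (α : Formula X) → (α.Occ → E) → Formula (X × E)
  | .fls, _ => .fls
  | .tru, _ => .tru
  | .atom a, l => .atom (a, l ())
  | .or α β, l => .or (pairs α fun i => l (.inl i)) (pairs β fun i => l (.inr i))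
  | .and α β, l => .and (pairs α fun i => l (.inl i)) (pairs β fun i => l (.inr i))

theorem map_fst_pairs {E : Type*} (α : Formula X) (l : α.Occ → E) :
    (pairs α l).map Prod.fst = α := by
  induction α <;> simp_all [pairs]

theorem mem_atoms_pairs {E : Type*} (α : Formula X) (l : α.Occ → E) (e : E) :
    e ∈ ((pairs α l).map Prod.snd).atoms ↔ ∃ i, l i = e := by
  induction α with
  | fls => exact ⟨fun h => by simp [pairs, atoms] at h, fun ⟨i, _⟩ => i.elim⟩
  | tru => exact ⟨fun h => by simp [pairs, atoms] at h, fun ⟨i, _⟩ => i.elim⟩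
  | atom a =>
    refine ⟨fun h => ⟨(), by simpa [pairs, atoms, eq_comm] using h⟩, ?_⟩
    rintro ⟨⟨⟩, rfl⟩
    simp [pairs, atoms]
  | or α β hα hβ | and α β hα hβ =>
    simp only [pairs, map_or, map_and, atoms, List.mem_append, hα, hβ]
    exact (Sum.exists (α := α.Occ) (β := β.Occ) (p := fun i => l i = e)).symm

theorem nodup_atoms_pairs {E : Type*} (α : Formula X) (l : α.Occ → E) :
    ((pairs α l).map Prod.snd).atoms.Nodup ↔ Function.Injective l := by
  induction α with
  | fls => exact ⟨fun _ i => i.elim, fun _ => by simp [pairs, atoms]⟩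
  | tru => exact ⟨fun _ i => i.elim, fun _ => by simp [pairs, atoms]⟩
  | atom a => exact ⟨fun _ _ _ _ => rfl, fun _ => by simp [pairs, atoms]⟩
  | or α β hα hβ | and α β hα hβ =>
    simp only [pairs, map_or, map_and, atoms, List.nodup_append, hα, hβ, mem_atoms_pairs]
    constructor
    · rintro ⟨h₁, h₂, h₃⟩ (i | i) (j | j) h
      · exact congrArg _ (h₁ h)
      · exact (h₃ _ ⟨i, rfl⟩ _ ⟨j, rfl⟩ h).elim
      · exact (h₃ _ ⟨j, rfl⟩ _ ⟨i, rfl⟩ h.symm).elim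
      · exact congrArg _ (h₂ h)
    · refine fun h => ⟨fun i j hij => Sum.inl_injective (h hij),
        fun i j hij => Sum.inr_injective (h hij), ?_⟩
      rintro _ ⟨i, rfl⟩ _ ⟨j, rfl⟩ hij
      cases h hij

theorem enumerates_pairs {E : Type*} (α : Formula X) (l : α.Occ → E) (S : Set E) :
    ((pairs α l).map Prod.snd).Enumerates S ↔ Set.BijOn l Set.univ S := by
  simp only [Enumerates, nodup_atoms_pairs, mem_atoms_pairs]
  constructor
  · exact fun ⟨h₁, h₂⟩ => ⟨fun i _ => (h₂ _).1 ⟨i, rfl⟩, h₁.injOn,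
      fun e he => by simpa using (h₂ e).2 he⟩
  · exact fun h => ⟨Set.injOn_univ.1 h.injOn, fun e =>
      ⟨by rintro ⟨i, rfl⟩; exact h.mapsTo trivial, fun he => by simpa using h.surjOn he⟩⟩

/-- The edges at the atom occurrences of `F.map x`. -/
def occ {E : Type*} (x : E → X) : (F : Formula E) → (F.map x).Occ → E
  | .fls => Empty.elim
  | .tru => Empty.elim
  | .atom e => fun _ => e
  | .or F G => Sum.elim (occ x F) (occ x G)
  | .and F G => Sum.elim (occ x F) (occ x G)

theorem pairs_occ {E : Type*} (x : E → X) (F : Formula E) :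
    pairs (F.map x) (occ x F) = F.map fun e => (x e, e) := by
  induction F with
  | fls | tru | atom e => rfl
  | or F G hF hG => exact congrArg₂ Formula.or hF hG
  | and F G hF hG => exact congrArg₂ Formula.and hF hG

theorem bijOn_occ {E : Type*} (x : E → X) (F : Formula E) {S : Set E} :
    Set.BijOn (occ x F) Set.univ S ↔ F.Enumerates S := by
  rw [← enumerates_pairs, pairs_occ, map_map, map_id]

variable [Atoms X]

theorem PreFlow.VertexAt.pairInst {A : PreFlow} {k : Label} {ν : A.V} {α β : Formula X}
    {l : α.Occ → A.E} {m : β.Occ → A.E} (h : A.VertexAt k ν l m)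
    (hs : Shape Prod.fst k (pairs α l) (pairs β m)) : A.PairInst ν (pairs α l) (pairs β m) :=
  ⟨h.1 ▸ hs, (enumerates_pairs ..).2 h.2.1, (enumerates_pairs ..).2 h.2.2⟩

theorem Rule.Traces.deduces {A : PreFlow} {α β : Formula X} (r : Rule α β) {l : α.Occ → A.E}
    {m : β.Occ → A.E} {vs : List A.V} (h : r.Traces A l m vs) :
    Deduces A.PairInst (pairs α l) (pairs β m) vs := by
  cases r with
  | aiDown a => obtain ⟨ν, rfl, h⟩ := h; exact .vertex _ (h.pairInst (.aiDown _ _ rfl))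
  | aiUp a => obtain ⟨ν, rfl, h⟩ := h; exact .vertex _ (h.pairInst (.aiUp _ _ rfl))
  | awDown a => obtain ⟨ν, rfl, h⟩ := h; exact .vertex _ (h.pairInst (.awDown _))
  | awUp a => obtain ⟨ν, rfl, h⟩ := h; exact .vertex _ (h.pairInst (.awUp _))
  | acDown a => obtain ⟨ν, rfl, h⟩ := h; exact .vertex _ (h.pairInst (.acDown _ _ _ rfl rfl))
  | acUp a => obtain ⟨ν, rfl, h⟩ := h; exact .vertex _ (h.pairInst (.acUp _ _ _ rfl rfl))
  | switch => obtain ⟨rfl, a, b, c, rfl, rfl⟩ := h; exact .lin (.switch ..)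
  | medial => obtain ⟨rfl, a, b, c, d, rfl, rfl⟩ := h; exact .lin (.medial ..)
  | orComm => obtain ⟨rfl, a, b, rfl, rfl⟩ := h; exact .lin (.orComm ..)
  | andComm => obtain ⟨rfl, a, b, rfl, rfl⟩ := h; exact .lin (.andComm ..)
  | orAssoc => obtain ⟨rfl, a, b, c, rfl, rfl⟩ := h; exact .lin (.orAssoc ..)
  | orAssocInv => obtain ⟨rfl, a, b, c, rfl, rfl⟩ := h; exact .lin (.orAssocInv ..)
  | andAssoc => obtain ⟨rfl, a, b, c, rfl, rfl⟩ := h; exact .lin (.andAssoc ..)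
  | andAssocInv => obtain ⟨rfl, a, b, c, rfl, rfl⟩ := h; exact .lin (.andAssocInv ..)
  | orUnit => obtain ⟨rfl, a, rfl, rfl⟩ := h; exact .lin (.orUnit _)
  | orUnitInv => obtain ⟨rfl, a, rfl, rfl⟩ := h; exact .lin (.orUnitInv _)
  | andUnit => obtain ⟨rfl, a, rfl, rfl⟩ := h; exact .lin (.andUnit _)
  | andUnitInv => obtain ⟨rfl, a, rfl, rfl⟩ := h; exact .lin (.andUnitInv _)
  | truTru => obtain rfl := h; exact .lin .truTru
  | truTruInv => obtain rfl := h; exact .lin .truTruInv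
  | flsFls => obtain rfl := h; exact .lin .flsFls
  | flsFlsInv => obtain rfl := h; exact .lin .flsFlsInv

theorem Step.Traces.deduces {A : PreFlow} {α β : Formula X} (s : Step α β) {l : α.Occ → A.E}
    {m : β.Occ → A.E} {vs : List A.V} (h : s.Traces A l m vs) :
    Deduces A.PairInst (pairs α l) (pairs β m) vs := by
  induction s with
  | rule r => exact Rule.Traces.deduces r h
  | orLeft s γ ih => obtain ⟨a, b, c, rfl, rfl, h⟩ := h; exact (ih h).orLeft _
  | orRight γ s ih => obtain ⟨a, b, c, rfl, rfl, h⟩ := h; exact (ih h).orRight _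
  | andLeft s γ ih => obtain ⟨a, b, c, rfl, rfl, h⟩ := h; exact (ih h).andLeft _
  | andRight γ s ih => obtain ⟨a, b, c, rfl, rfl, h⟩ := h; exact (ih h).andRight _

theorem Deriv.Traces.deduces {A : PreFlow} {α β : Formula X} (Φ : Deriv α β) {l : α.Occ → A.E}
    {m : β.Occ → A.E} {vs : List A.V} (h : Φ.Traces A l m vs) :
    Deduces A.PairInst (pairs α l) (pairs β m) vs := by
  induction Φ generalizing vs with
  | nil α => obtain ⟨rfl, rfl⟩ := h; exact .refl _
  | cons s Φ ih =>
    obtain ⟨n, vs₁, vs₂, hs, hΦ, rfl⟩ := h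
    exact (Step.Traces.deduces s hs).trans (ih hΦ)

/-- If each vertex is used at most once, then all occurrences of an edge carry the same atom,
because an edge is only introduced at its upper vertex. So there is a labelling of the edges,
which extends a given labelling `x₀` of the edges in the premiss. The last clause is about all
labellings `y` that agree with it on the edges that occur, because the labelling changes on other
edges when a second deduction is appended. -/
theorem Deduces.exists_labelling {A : PreFlow} {F G : Formula (X × A.E)} {vs : List A.V}
    (h : Deduces A.PairInst F G vs) (hvs : vs.Nodup) (x₀ : A.E → X)
    (hx₀ : ∀ p ∈ F.atoms, x₀ p.2 = p.1) (hF : ∀ p ∈ F.atoms, ∀ ν ∈ vs, A.up p.2 ≠ some ν) :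
    ∃ x : A.E → X, (∀ e, (∀ ν ∈ vs, A.up e ≠ some ν) → x e = x₀ e) ∧
      (∀ p ∈ G.atoms, x p.2 = p.1 ∧ (p ∈ F.atoms ∨ ∃ ν ∈ vs, A.up p.2 = some ν)) ∧
      ∀ y : A.E → X, (∀ p ∈ F.atoms, y p.2 = p.1) →
        (∀ e, (∃ ν ∈ vs, A.up e = some ν) → y e = x e) →
        Deduces (A.Inst y) (F.map Prod.snd) (G.map Prod.snd) vs := by
  classical
  induction h generalizing x₀ with
  | lin h =>
    exact ⟨x₀, fun _ _ => rfl, fun p hp => ⟨hx₀ p (h.mem_atoms hp), .inl (h.mem_atoms hp)⟩,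
      fun y _ _ => .lin (h.bind _)⟩
  | refl => exact ⟨x₀, fun _ _ => rfl, fun p hp => ⟨hx₀ p hp, .inl hp⟩, fun y _ _ => .refl _⟩
  | @vertex F G ν h =>
    have hinj : ∀ p ∈ G.atoms, ∀ q ∈ G.atoms, p.2 = q.2 → p = q := fun p hp q hq =>
      List.inj_on_of_nodup_map (by simpa using h.lower.1) hp hq
    have hup : ∀ p ∈ G.atoms, A.up p.2 = some ν := fun p hp =>
      (h.lower.2 p.2).1 (by simpa using ⟨p.1, hp⟩)
    let x : A.E → X := fun e => if hp : ∃ p ∈ G.atoms, p.2 = e then hp.choose.1 else x₀ e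
    have hx : ∀ p ∈ G.atoms, x p.2 = p.1 := fun p hp => by
      have hp' : ∃ q ∈ G.atoms, q.2 = p.2 := ⟨p, hp, rfl⟩
      simp only [x, dif_pos hp']
      rw [hinj _ hp'.choose_spec.1 p hp hp'.choose_spec.2]
    refine ⟨x, fun e he => dif_neg ?_, fun p hp => ⟨hx p hp, .inr ⟨ν, by simp, hup p hp⟩⟩,
      fun y hyF hyG => .vertex ν ⟨?_, h.upper, h.lower⟩⟩
    · rintro ⟨p, hp, rfl⟩
      exact he ν (by simp) (hup p hp)
    · exact h.shape.map hyF fun p hp => (hyG _ ⟨ν, by simp, hup p hp⟩).trans (hx p hp)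
  | @trans F G H vs ws h₁ h₂ ih₁ ih₂ =>
    obtain ⟨hvs₁, hvs₂, hd⟩ := List.nodup_append.1 hvs
    obtain ⟨x₁, ho₁, hG₁, hd₁⟩ := ih₁ hvs₁ x₀ hx₀ fun p hp ν hν => hF p hp ν (by simp [hν])
    have hG : ∀ p ∈ G.atoms, ∀ ν ∈ ws, A.up p.2 ≠ some ν := by
      intro p hp ν hν hup
      rcases (hG₁ p hp).2 with h | ⟨ν', hν', h⟩
      · exact hF p h ν (by simp [hν]) hup
      · exact hd _ hν' _ hν (Option.some_injective _ (h.symm.trans hup))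
    obtain ⟨x₂, ho₂, hG₂, hd₂⟩ := ih₂ hvs₂ x₁ (fun p hp => (hG₁ p hp).1) hG
    have h12 : ∀ e, (∃ ν ∈ vs, A.up e = some ν) → x₂ e = x₁ e := by
      rintro e ⟨ν, hν, he⟩
      refine ho₂ e fun ν' hν' he' => ?_
      exact hd _ hν _ hν' (Option.some_injective _ (he.symm.trans he'))
    refine ⟨x₂, fun e he => ?_, fun p hp => ⟨(hG₂ p hp).1, ?_⟩, fun y hyF hyG => ?_⟩
    · rw [ho₂ e fun ν hν => he ν (by simp [hν]), ho₁ e fun ν hν => he ν (by simp [hν])]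
    · rcases (hG₂ p hp).2 with h | ⟨ν, hν, h⟩
      · rcases (hG₁ p h).2 with h | ⟨ν, hν, h⟩
        · exact .inl h
        · exact .inr ⟨ν, by simp [hν], h⟩
      · exact .inr ⟨ν, by simp [hν], h⟩
    · have hy₁ : ∀ e, (∃ ν ∈ vs, A.up e = some ν) → y e = x₁ e := by
        rintro e ⟨ν, hν, he⟩
        rw [hyG e ⟨ν, by simp [hν], he⟩, h12 e ⟨ν, hν, he⟩]
      refine (hd₁ y hyF hy₁).trans (hd₂ y (fun p hp => ?_) ?_)
      · rcases (hG₁ p hp).2 with h | h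
        · exact hyF p h
        · exact (hy₁ _ h).trans (hG₁ p hp).1
      · rintro e ⟨ν, hν, he⟩
        exact hyG e ⟨ν, by simp [hν], he⟩
  | @orLeft F G vs _ H ih =>
    simp only [atoms, List.mem_append] at hx₀ hF
    obtain ⟨x, ho, hG, hd⟩ := ih hvs x₀ (fun p hp => hx₀ p (.inl hp)) fun p hp => hF p (.inl hp)
    refine ⟨x, ho, fun p hp => ?_, fun y hyF hyG => (hd y (fun p hp => hyF p ?_) hyG).orLeft _⟩
    · simp only [atoms, List.mem_append] at hp ⊢
      rcases hp with hp | hp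
      · exact ⟨(hG p hp).1, (hG p hp).2.imp_left .inl⟩
      · exact ⟨(ho _ (hF p (.inr hp))).trans (hx₀ p (.inr hp)), .inl (.inr hp)⟩
    · simp [atoms, hp]
  | @andLeft F G vs _ H ih =>
    simp only [atoms, List.mem_append] at hx₀ hF
    obtain ⟨x, ho, hG, hd⟩ := ih hvs x₀ (fun p hp => hx₀ p (.inl hp)) fun p hp => hF p (.inl hp)
    refine ⟨x, ho, fun p hp => ?_, fun y hyF hyG => (hd y (fun p hp => hyF p ?_) hyG).andLeft _⟩
    · simp only [atoms, List.mem_append] at hp ⊢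
      rcases hp with hp | hp
      · exact ⟨(hG p hp).1, (hG p hp).2.imp_left .inl⟩
      · exact ⟨(ho _ (hF p (.inr hp))).trans (hx₀ p (.inr hp)), .inl (.inr hp)⟩
    · simp [atoms, hp]
  | @orRight F G vs H _ ih =>
    simp only [atoms, List.mem_append] at hx₀ hF
    obtain ⟨x, ho, hG, hd⟩ := ih hvs x₀ (fun p hp => hx₀ p (.inr hp)) fun p hp => hF p (.inr hp)
    refine ⟨x, ho, fun p hp => ?_, fun y hyF hyG => (hd y (fun p hp => hyF p ?_) hyG).orRight _⟩
    · simp only [atoms, List.mem_append] at hp ⊢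
      rcases hp with hp | hp
      · exact ⟨(ho _ (hF p (.inl hp))).trans (hx₀ p (.inl hp)), .inl (.inl hp)⟩
      · exact ⟨(hG p hp).1, (hG p hp).2.imp_left .inr⟩
    · simp [atoms, hp]
  | @andRight F G vs H _ ih =>
    simp only [atoms, List.mem_append] at hx₀ hF
    obtain ⟨x, ho, hG, hd⟩ := ih hvs x₀ (fun p hp => hx₀ p (.inr hp)) fun p hp => hF p (.inr hp)
    refine ⟨x, ho, fun p hp => ?_, fun y hyF hyG => (hd y (fun p hp => hyF p ?_) hyG).andRight _⟩
    · simp only [atoms, List.mem_append] at hp ⊢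
      rcases hp with hp | hp
      · exact ⟨(ho _ (hF p (.inl hp))).trans (hx₀ p (.inl hp)), .inl (.inl hp)⟩
      · exact ⟨(hG p hp).1, (hG p hp).2.imp_left .inr⟩
    · simp [atoms, hp]

/-- A labelling of the upper edges of the flow, to begin with, can be read off the premiss. -/
theorem Deriv.HasFlow.exists_realizes {A : Flow} {α β : Formula X} {Φ : Deriv α β}
    (h : Φ.HasFlow A) : ∃ (x : A.E → X) (F G : Formula A.E), A.Realizes x F G ∧
      F.map x = α ∧ G.map x = β ∧ F.Enumerates {e | A.up e = none} ∧
      G.Enumerates {e | A.lo e = none} := by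
  classical
  obtain ⟨l, m, vs, ht, hvs, hall, hl, hm⟩ := h
  rw [← enumerates_pairs] at hl hm
  have hd := Deriv.Traces.deduces Φ ht
  have hmap : ∀ (γ : Formula X) (n : γ.Occ → A.E) (x : A.E → X),
      (∀ p ∈ (pairs γ n).atoms, x p.2 = p.1) → ((pairs γ n).map Prod.snd).map x = γ := by
    intro γ n x hx
    rw [map_map, map_congr hx, map_fst_pairs]
  have hinj : ∀ p ∈ (pairs α l).atoms, ∀ q ∈ (pairs α l).atoms, p.2 = q.2 → p = q :=
    fun p hp q hq => List.inj_on_of_nodup_map (by simpa using hl.1) hp hq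
  obtain ⟨x₀, hx₀⟩ : ∃ x₀ : A.E → X, ∀ p ∈ (pairs α l).atoms, x₀ p.2 = p.1 := by
    rcases isEmpty_or_nonempty X with hX | ⟨⟨a⟩⟩
    -- Without atoms there is no value to choose for a label, but there are no edges, either.
    · have hE : IsEmpty A.E := by
        refine ⟨fun e => ?_⟩
        rcases he : A.up e with _ | ν
        · have hmem := (hl.2 e).2 he
          rw [atoms_map] at hmem
          obtain ⟨p, -⟩ := List.mem_map.1 hmem
          exact isEmptyElim p
        · obtain ⟨F, G, h⟩ := hd.exists_of_mem (hall ν)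
          have hmem := (h.lower.2 e).2 he
          rw [atoms_map] at hmem
          obtain ⟨p, -⟩ := List.mem_map.1 hmem
          exact isEmptyElim p
      exact ⟨isEmptyElim, fun p => isEmptyElim p.1⟩
    · refine ⟨fun e => if hp : ∃ p ∈ (pairs α l).atoms, p.2 = e then hp.choose.1 else a,
        fun p hp => ?_⟩
      have hp' : ∃ q ∈ (pairs α l).atoms, q.2 = p.2 := ⟨p, hp, rfl⟩
      simp only [dif_pos hp']
      rw [hinj _ hp'.choose_spec.1 p hp hp'.choose_spec.2]
  have hup : ∀ p ∈ (pairs α l).atoms, ∀ ν ∈ vs, A.up p.2 ≠ some ν := by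
    intro p hp ν _ hν
    have : A.up p.2 = none := (hl.2 p.2).1 (by simpa using ⟨p.1, hp⟩)
    simp [this] at hν
  obtain ⟨x, ho, hG, hd⟩ := hd.exists_labelling hvs x₀ hx₀ hup
  have hx : ∀ p ∈ (pairs α l).atoms, x p.2 = p.1 := fun p hp => by
    rw [ho _ (hup p hp), hx₀ p hp]
  exact ⟨x, _, _, ⟨vs, hd x hx fun _ _ => rfl, hvs, hall⟩, hmap _ _ _ hx,
    hmap _ _ _ fun p hp => (hG p hp).1, hl, hm⟩

end Traces

/-! ### From deductions to derivations -/

section Derivations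

variable {X : Type u} [Atoms X]

/-- The derivation that consists of one inference step. -/
def Deriv.single {α β : Formula X} (s : Step α β) : Deriv α β := .cons s (.nil β)

theorem Step.Traces.single {A : PreFlow} {α β : Formula X} {s : Step α β} {l : α.Occ → A.E}
    {m : β.Occ → A.E} {vs : List A.V} (h : s.Traces A l m vs) :
    (Deriv.single s).Traces A l m vs :=
  ⟨m, vs, [], h, ⟨rfl, rfl⟩, by simp⟩

theorem Deriv.Traces.exists_trans {A : PreFlow} {α β γ : Formula X} (Φ : Deriv α β)
    (Ψ : Deriv β γ) {l : α.Occ → A.E} {m : β.Occ → A.E} {n : γ.Occ → A.E} {vs ws : List A.V}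
    (h₁ : Φ.Traces A l m vs) (h₂ : Ψ.Traces A m n ws) :
    ∃ Θ : Deriv α γ, Θ.Traces A l n (vs ++ ws) := by
  induction Φ generalizing vs with
  | nil => obtain ⟨rfl, rfl⟩ := h₁; exact ⟨Ψ, h₂⟩
  | cons s Φ ih =>
    obtain ⟨k, vs₁, vs₂, hs, hΦ, rfl⟩ := h₁
    obtain ⟨Θ, hΘ⟩ := ih Ψ hΦ h₂
    exact ⟨.cons s Θ, k, vs₁, vs₂ ++ ws, hs, hΘ, List.append_assoc ..⟩

/-- If each inference step can be put into the context `C`, then so can each derivation. The map `c`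
extends the edges of a formula by those of the context. -/
theorem Deriv.Traces.exists_context {A : PreFlow} {α β : Formula X} (Φ : Deriv α β)
    {l : α.Occ → A.E} {m : β.Occ → A.E} {vs : List A.V} (h : Φ.Traces A l m vs)
    (C : Formula X → Formula X) (c : ∀ {γ : Formula X}, (γ.Occ → A.E) → ((C γ).Occ → A.E))
    (hC : ∀ {γ δ : Formula X} (s : Step γ δ) {l : γ.Occ → A.E} {m : δ.Occ → A.E} {vs : List A.V},
      s.Traces A l m vs → ∃ s' : Step (C γ) (C δ), s'.Traces A (c l) (c m) vs) :
    ∃ Ψ : Deriv (C α) (C β), Ψ.Traces A (c l) (c m) vs := by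
  induction Φ generalizing vs with
  | nil => obtain ⟨rfl, rfl⟩ := h; exact ⟨.nil _, rfl, rfl⟩
  | cons s Φ ih =>
    obtain ⟨k, vs₁, vs₂, hs, hΦ, rfl⟩ := h
    obtain ⟨s', hs'⟩ := hC s hs
    obtain ⟨Ψ, hΨ⟩ := ih hΦ
    exact ⟨.cons s' Ψ, c k, vs₁, vs₂, hs', hΨ, rfl⟩

theorem Formula.Lin.exists_rule {A : PreFlow} (x : A.E → X) {F G : Formula A.E} (h : Lin F G) :
    ∃ r : Rule (F.map x) (G.map x), r.Traces A (occ x F) (occ x G) [] := by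
  cases h with
  | switch => exact ⟨.switch .., rfl, _, _, _, rfl, rfl⟩
  | medial => exact ⟨.medial .., rfl, _, _, _, _, rfl, rfl⟩
  | orComm => exact ⟨.orComm .., rfl, _, _, rfl, rfl⟩
  | andComm => exact ⟨.andComm .., rfl, _, _, rfl, rfl⟩
  | orAssoc => exact ⟨.orAssoc .., rfl, _, _, _, rfl, rfl⟩
  | orAssocInv => exact ⟨.orAssocInv .., rfl, _, _, _, rfl, rfl⟩
  | andAssoc => exact ⟨.andAssoc .., rfl, _, _, _, rfl, rfl⟩
  | andAssocInv => exact ⟨.andAssocInv .., rfl, _, _, _, rfl, rfl⟩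
  | orUnit => exact ⟨.orUnit _, rfl, _, rfl, rfl⟩
  | orUnitInv => exact ⟨.orUnitInv _, rfl, _, rfl, rfl⟩
  | andUnit => exact ⟨.andUnit _, rfl, _, rfl, rfl⟩
  | andUnitInv => exact ⟨.andUnitInv _, rfl, _, rfl, rfl⟩
  | truTru => exact ⟨.truTru, rfl⟩
  | truTruInv => exact ⟨.truTruInv, rfl⟩
  | flsFls => exact ⟨.flsFls, rfl⟩
  | flsFlsInv => exact ⟨.flsFlsInv, rfl⟩

theorem PreFlow.Inst.exists_rule {A : PreFlow} {x : A.E → X} {ν : A.V} {F G : Formula A.E}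
    (h : A.Inst x ν F G) :
    ∃ r : Rule (F.map x) (G.map x), r.Traces A (occ x F) (occ x G) [ν] := by
  obtain ⟨hs, hU, hL⟩ := h
  rw [← bijOn_occ x] at hU hL
  generalize hk : A.η ν = k at hs
  -- The labels of the edges are only propositionally the atoms that the rules ask for, so they are
  -- generalized before they are eliminated.
  cases hs with
  | aiDown e e' h =>
    have key : ∀ a, a = Atoms.bar (x e) →
        ∀ m : (Formula.or (.atom (x e)) (.atom a)).Occ → A.E,
        Set.BijOn m Set.univ (A.lowerEdges ν) →
        ∃ r : Rule .tru (.or (.atom (x e)) (.atom a)), r.Traces A (occ x .tru) m [ν] := by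
      rintro _ rfl m hm
      exact ⟨.aiDown _, ν, rfl, hk, hU, hm⟩
    exact key _ h _ hL
  | aiUp e e' h =>
    have key : ∀ a, a = Atoms.bar (x e) →
        ∀ l : (Formula.and (.atom (x e)) (.atom a)).Occ → A.E,
        Set.BijOn l Set.univ (A.upperEdges ν) →
        ∃ r : Rule (.and (.atom (x e)) (.atom a)) .fls, r.Traces A l (occ x .fls) [ν] := by
      rintro _ rfl l hl
      exact ⟨.aiUp _, ν, rfl, hk, hl, hL⟩
    exact key _ h _ hU
  | awDown e => exact ⟨.awDown _, ν, rfl, hk, hU, hL⟩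
  | awUp e => exact ⟨.awUp _, ν, rfl, hk, hU, hL⟩
  | acDown e₁ e₂ e h₁ h₂ =>
    have key : ∀ a b, a = x e → b = x e →
        ∀ l : (Formula.or (.atom a) (.atom b)).Occ → A.E,
        Set.BijOn l Set.univ (A.upperEdges ν) →
        ∃ r : Rule (.or (.atom a) (.atom b)) (.atom (x e)),
          r.Traces A l (occ x (.atom e)) [ν] := by
      rintro _ _ rfl rfl l hl
      exact ⟨.acDown _, ν, rfl, hk, hl, hL⟩
    exact key _ _ h₁ h₂ _ hU
  | acUp e₁ e₂ e h₁ h₂ =>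
    have key : ∀ a b, a = x e → b = x e →
        ∀ m : (Formula.and (.atom a) (.atom b)).Occ → A.E,
        Set.BijOn m Set.univ (A.lowerEdges ν) →
        ∃ r : Rule (.atom (x e)) (.and (.atom a) (.atom b)),
          r.Traces A (occ x (.atom e)) m [ν] := by
      rintro _ _ rfl rfl m hm
      exact ⟨.acUp _, ν, rfl, hk, hU, hm⟩
    exact key _ _ h₁ h₂ _ hL

theorem Deduces.exists_deriv {A : PreFlow} {x : A.E → X} {F G : Formula A.E} {vs : List A.V}
    (h : Deduces (A.Inst x) F G vs) :
    ∃ Φ : Deriv (F.map x) (G.map x), Φ.Traces A (occ x F) (occ x G) vs := by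
  induction h with
  | lin h => obtain ⟨r, hr⟩ := h.exists_rule x; exact ⟨_, Step.Traces.single (s := .rule r) hr⟩
  | vertex ν h => obtain ⟨r, hr⟩ := h.exists_rule; exact ⟨_, Step.Traces.single (s := .rule r) hr⟩
  | refl => exact ⟨.nil _, rfl, rfl⟩
  | trans _ _ ih₁ ih₂ =>
    obtain ⟨Φ, hΦ⟩ := ih₁
    obtain ⟨Ψ, hΨ⟩ := ih₂
    exact hΦ.exists_trans _ Ψ hΨ
  | orLeft _ H ih =>
    obtain ⟨Φ, hΦ⟩ := ih
    exact hΦ.exists_context Φ (fun γ => .or γ (H.map x)) (fun l => Sum.elim l (occ x H))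
      fun s _ _ _ h => ⟨.orLeft s _, _, _, _, rfl, rfl, h⟩
  | orRight H _ ih =>
    obtain ⟨Φ, hΦ⟩ := ih
    exact hΦ.exists_context Φ (fun γ => .or (H.map x) γ) (fun l => Sum.elim (occ x H) l)
      fun s _ _ _ h => ⟨.orRight _ s, _, _, _, rfl, rfl, h⟩
  | andLeft _ H ih =>
    obtain ⟨Φ, hΦ⟩ := ih
    exact hΦ.exists_context Φ (fun γ => .and γ (H.map x)) (fun l => Sum.elim l (occ x H))
      fun s _ _ _ h => ⟨.andLeft s _, _, _, _, rfl, rfl, h⟩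
  | andRight H _ ih =>
    obtain ⟨Φ, hΦ⟩ := ih
    exact hΦ.exists_context Φ (fun γ => .and (H.map x) γ) (fun l => Sum.elim (occ x H) l)
      fun s _ _ _ h => ⟨.andRight _ s, _, _, _, rfl, rfl, h⟩

theorem PreFlow.Realizes.exists_hasFlow {A : Flow} {x : A.E → X} {F G : Formula A.E}
    (h : A.Realizes x F G) (hF : F.Enumerates {e | A.up e = none})
    (hG : G.Enumerates {e | A.lo e = none}) :
    ∃ Φ : Deriv (F.map x) (G.map x), Φ.HasFlow A := by
  obtain ⟨vs, h, hvs, hall⟩ := h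
  obtain ⟨Φ, hΦ⟩ := h.exists_deriv
  exact ⟨Φ, _, _, vs, hΦ, hvs, hall, (bijOn_occ ..).2 hF, (bijOn_occ ..).2 hG⟩

end Derivations

/-! ### Isomorphic flows -/

section Iso

variable {X : Type u} [Atoms X]

theorem PreFlow.Realizes.iso {A A' : PreFlow} (φ : PreFlow.Iso A A') {x : A'.E → X}
    {F G : Formula A'.E} (h : A'.Realizes x F G) :
    A.Realizes (fun e => x (φ.e e)) (F.map φ.e.symm) (G.map φ.e.symm) := by
  obtain ⟨vs, h, hvs, hall⟩ := h
  refine ⟨vs.map φ.v.symm, h.map _ _ fun ν F G h => ?_, hvs.map φ.v.symm.injective,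
    fun ν => List.mem_map.2 ⟨φ.v ν, hall _, by simp⟩⟩
  refine h.map ?_ ?_ ?_ φ.e.symm.injective.injOn φ.e.symm.injective.injOn
    (by simp) (by simp)
  · rw [← φ.map_η, Equiv.apply_symm_apply]
  · ext e
    simp only [PreFlow.upperEdges, Equiv.image_symm_eq_preimage, Set.mem_preimage,
      Set.mem_ofPred_eq, φ.map_lo]
    cases A.lo e <;> simp [Equiv.eq_symm_apply]
  · ext e
    simp only [PreFlow.lowerEdges, Equiv.image_symm_eq_preimage, Set.mem_preimage,
      Set.mem_ofPred_eq, φ.map_up]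
    cases A.up e <;> simp [Equiv.eq_symm_apply]

end Iso

/-! ### Removing a simple edge -/

section Erase

variable {X : Type u} [Atoms X] {B : PreFlow}

section

variable {e : B.E} {d w : B.V} {k : Label}

/-- The edge of `B` that is kept as the edge `a`. -/
def eraseVal (a : (B.erase e d w k).E) : B.E := a.1

/-- The edge `a` of `B`, as an edge that is kept. -/
def eraseEdge (a : B.E) (h : a ≠ e) : (B.erase e d w k).E := ⟨a, h⟩

/-- The vertex `ν` of `B`, as a vertex that is kept. -/
def eraseVertex (ν : B.V) (h : ν ≠ d) : (B.erase e d w k).V := ⟨ν, h⟩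

@[simp] theorem eraseVal_eraseEdge (a : B.E) (h : a ≠ e) :
    eraseVal (eraseEdge a h : (B.erase e d w k).E) = a := rfl

theorem eraseVal_ne (a : (B.erase e d w k).E) : eraseVal a ≠ e := a.2

theorem eraseVal_injective : Function.Injective (eraseVal : (B.erase e d w k).E → B.E) :=
  Subtype.val_injective

theorem erase_up (a : (B.erase e d w k).E) {ν : B.V} (hν : ν ≠ d) :
    (B.erase e d w k).up a = some (eraseVertex ν hν) ↔ B.up (eraseVal a) = some ν := by
  refine Option.bind_eq_some_iff.trans ⟨?_, fun h => ⟨ν, h, dif_pos hν⟩⟩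
  rintro ⟨ν', h, h'⟩
  split at h'
  · cases h'
    exact h
  · cases h'

theorem erase_lo (a : (B.erase e d w k).E) {ν : B.V} (hν : ν ≠ d) :
    (B.erase e d w k).lo a = some (eraseVertex ν hν) ↔ B.lo (eraseVal a) = some ν := by
  refine Option.bind_eq_some_iff.trans ⟨?_, fun h => ⟨ν, h, dif_pos hν⟩⟩
  rintro ⟨ν', h, h'⟩
  split at h'
  · cases h'
    exact h
  · cases h'

theorem erase_η_self (hw : w ≠ d) : (B.erase e d w k).η (eraseVertex w hw) = k :=
  if_pos rfl

theorem erase_η_of_ne {ν : B.V} (hν : ν ≠ d) (hw : ν ≠ w) :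
    (B.erase e d w k).η (eraseVertex ν hν) = B.η ν :=
  if_neg hw

open Classical in
/-- The substitution for the edges of `B` that puts `c` in place of `e`. -/
noncomputable def eraseSubst (c : Formula (B.erase e d w k).E) (a : B.E) :
    Formula (B.erase e d w k).E :=
  if h : a ≠ e then .atom (eraseEdge a h) else c

theorem eraseSubst_self (c : Formula (B.erase e d w k).E) : eraseSubst c e = c :=
  dif_neg (by simp)

theorem eraseSubst_of_ne (c : Formula (B.erase e d w k).E) {a : B.E} (h : a ≠ e) :
    eraseSubst c a = .atom (eraseEdge a h) :=
  dif_pos h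

theorem map_bind_eraseSubst {T : Type*} (c : Formula (B.erase e d w k).E)
    (P : Formula T) {b : T → B.E} (hb : ∀ t, b t ≠ e) :
    (P.map b).bind (eraseSubst c) = P.map fun t => eraseEdge (b t) (hb t) := by
  rw [bind_map]
  exact bind_congr fun t _ => eraseSubst_of_ne c (hb t)

theorem Shape.exists_mem {E : Type*} {x : E → X} {k : Label} {F G : Formula E}
    (h : Shape x k F G) : ∃ a, a ∈ F.atoms ∨ a ∈ G.atoms := by
  cases h <;> simp [atoms]

/-- Vertices that are not incident with the erased edge keep their steps. -/
theorem PreFlow.Inst.erase {x : B.E → X} {ν : B.V} {F G : Formula B.E} (h : B.Inst x ν F G)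
    (hd : ν ≠ d) (hw : ν ≠ w) (hup : B.up e ≠ some ν) (hlo : B.lo e ≠ some ν)
    (c : Formula (B.erase e d w k).E) :
    (B.erase e d w k).Inst (fun a => x (eraseVal a)) (eraseVertex ν hd)
      (F.bind (eraseSubst c)) (G.bind (eraseSubst c)) := by
  classical
  have hU : ∀ a ∈ B.upperEdges ν, a ≠ e := by rintro a ha rfl; exact hlo ha
  have hL : ∀ a ∈ B.lowerEdges ν, a ≠ e := by rintro a ha rfl; exact hup ha
  -- Every vertex has an edge, so a default value for the renaming is at hand.
  obtain ⟨a₀⟩ : Nonempty (B.erase e d w k).E := by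
    obtain ⟨a, ha⟩ := h.shape.exists_mem
    rw [h.upper.2, h.lower.2] at ha
    exact ⟨eraseEdge a (ha.elim (hU a) (hL a))⟩
  let g : B.E → (B.erase e d w k).E := fun a => if ha : a ≠ e then eraseEdge a ha else a₀
  have hg : ∀ a (ha : a ≠ e), g a = eraseEdge a ha := fun a ha => dif_pos ha
  have hF : F.bind (eraseSubst c) = F.map g := bind_congr fun a ha => by
    have := hU a ((h.upper.2 a).1 ha)
    rw [eraseSubst_of_ne c this, hg a this]
  have hG : G.bind (eraseSubst c) = G.map g := bind_congr fun a ha => by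
    have := hL a ((h.lower.2 a).1 ha)
    rw [eraseSubst_of_ne c this, hg a this]
  rw [hF, hG]
  have hinj : ∀ {S : Set B.E}, (∀ a ∈ S, a ≠ e) → Set.InjOn g S := fun hS a ha b hb hab => by
    rw [hg a (hS a ha), hg b (hS b hb)] at hab
    exact congrArg eraseVal hab
  have himage : ∀ {S : Set B.E} {S' : Set (B.erase e d w k).E}, (∀ a ∈ S, a ≠ e) →
      (∀ a, a ∈ S' ↔ eraseVal a ∈ S) → S' = g '' S := fun {S S'} hS hS' => by
    ext a
    rw [hS']
    constructor
    · exact fun ha => ⟨eraseVal a, ha, hg _ (eraseVal_ne a)⟩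
    · rintro ⟨b, hb, rfl⟩
      rwa [hg b (hS b hb)]
  refine h.map (erase_η_of_ne hd hw) (himage hU fun a => erase_lo a hd)
    (himage hL fun a => erase_up a hd) (hinj hU) (hinj hL) (fun a ha => ?_) fun a ha => ?_
  · rw [hg a (hU a ha), eraseVal_eraseEdge]
  · rw [hg a (hL a ha), eraseVal_eraseEdge]

open Classical in
/-- The vertex `ν` of `B`, if it is kept. -/
noncomputable def eraseVertexOpt (ν : B.V) : Option (B.erase e d w k).V :=
  if h : ν ≠ d then some (eraseVertex ν h) else none

theorem nodup_filterMap_eraseVertex {vs : List B.V} (hvs : vs.Nodup) (hall : ∀ ν, ν ∈ vs) :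
    (vs.filterMap (eraseVertexOpt (e := e) (d := d) (w := w) (k := k))).Nodup ∧
      ∀ ν, ν ∈ vs.filterMap (eraseVertexOpt (e := e) (d := d) (w := w) (k := k)) := by
  refine ⟨hvs.filterMap fun ν ν' b hb hb' => ?_,
    fun ν => List.mem_filterMap.2 ⟨ν.1, hall _, dif_pos ν.2⟩⟩
  simp only [eraseVertexOpt, Option.mem_def] at hb hb'
  split at hb <;> split at hb' <;> simp only [reduceCtorEq, Option.some.injEq] at hb hb'
  exact congrArg Subtype.val (hb.trans hb'.symm)

end

theorem eq_or_eq_of_mem_pair {E : Type*} {e e' a b : E} {S : Set E}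
    (h : ∀ y, y ∈ [e] ++ [e'] ↔ y ∈ S) (ha : a ∈ S) (hb : b ∈ S) (hab : a ≠ b) :
    (e = a ∧ e' = b) ∨ (e = b ∧ e' = a) := by
  have ha := (h a).2 ha
  have hb := (h b).2 hb
  simp only [List.cons_append, List.nil_append, List.mem_cons, List.not_mem_nil, or_false]
    at ha hb
  rcases ha with rfl | rfl <;> rcases hb with rfl | rfl <;> simp_all

namespace PreFlow.SimplePair

variable (s : B.SimplePair) {x : B.E → X} {F G : Formula B.E}

theorem inst_i (h : B.Inst x s.i F G) : F = .tru ∧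
    (G = .or (.atom s.e₁) (.atom s.e₂) ∨ G = .or (.atom s.e₂) (.atom s.e₁)) ∧
    x s.e₂ = Atoms.bar (x s.e₁) := by
  obtain ⟨hs, hU, hL⟩ := h
  rw [s.η_i] at hs
  cases hs with
  | aiDown e e' h =>
    rcases eq_or_eq_of_mem_pair hL.2 s.up_e₁ s.up_e₂ s.e₂_ne.symm with ⟨rfl, rfl⟩ | ⟨rfl, rfl⟩
    · exact ⟨rfl, .inl rfl, h⟩
    · exact ⟨rfl, .inr rfl, by rw [h, Atoms.bar_bar]⟩

theorem inst_j (h : B.Inst x s.j F G) : G = .fls ∧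
    (F = .and (.atom s.e₁) (.atom s.e₃) ∨ F = .and (.atom s.e₃) (.atom s.e₁)) ∧
    x s.e₃ = Atoms.bar (x s.e₁) := by
  obtain ⟨hs, hU, hL⟩ := h
  rw [s.η_j] at hs
  cases hs with
  | aiUp e e' h =>
    rcases eq_or_eq_of_mem_pair hU.2 s.lo_e₁ s.lo_e₃ s.e₃_ne.symm with ⟨rfl, rfl⟩ | ⟨rfl, rfl⟩
    · exact ⟨rfl, .inl rfl, h⟩
    · exact ⟨rfl, .inr rfl, by rw [h, Atoms.bar_bar]⟩

theorem label_eq (h : B.Realizes x F G) : x s.e₃ = x s.e₂ := by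
  obtain ⟨vs, h, -, hall⟩ := h
  obtain ⟨_, _, hi⟩ := h.exists_of_mem (hall s.i)
  obtain ⟨_, _, hj⟩ := h.exists_of_mem (hall s.j)
  rw [(s.inst_i hi).2.2, (s.inst_j hj).2.2]

end PreFlow.SimplePair

/-- If `e₁` is replaced with `t`, the interaction `i` becomes the weakening `f → e₂` in the context
of a disjunction with `t`, and the premiss `(t . e₃)` of the cointeraction `j` is `e₃`, which is
pulled out into the conclusion. -/
theorem PreFlow.SimplePair.realizes_weakened (s : B.SimplePair) {x : B.E → X} {T U : Type}
    {P : Formula T} {Q : Formula U} {p : T → B.E} {q : U → B.E} (hp : ∀ t, p t ≠ s.e₁)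
    (hq : ∀ u, q u ≠ s.e₁) (h : B.Realizes x (P.map p) (Q.map q)) :
    (B.erase s.e₁ s.j s.i .awDown).Realizes (fun a => x (eraseVal a))
      (P.map fun t => eraseEdge (p t) (hp t))
      (.or (Q.map fun u => eraseEdge (q u) (hq u)) (.atom (eraseEdge s.e₃ s.e₃_ne))) := by
  classical
  obtain ⟨vs, h, hvs, hall⟩ := h
  refine ⟨vs.filterMap eraseVertexOpt, ?_,
    nodup_filterMap_eraseVertex hvs hall⟩
  rw [← map_bind_eraseSubst .tru P hp, ← map_bind_eraseSubst .tru Q hq]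
  refine h.bind_or _ _ s.j _ (fun ν hν F G h => ?_) (fun F G h => ?_) hvs (hall _)
  · rw [eraseVertexOpt, dif_pos hν]
    by_cases hi : ν = s.i
    · subst hi
      have hinst : (B.erase s.e₁ s.j s.i .awDown).Inst (fun a => x (eraseVal a))
          (eraseVertex s.i hν) .fls (.atom (eraseEdge s.e₂ s.e₂_ne)) := by
        refine ⟨?_, ⟨by simp [atoms], fun a => ?_⟩, ⟨by simp [atoms], fun a => ?_⟩⟩
        · rw [erase_η_self]
          exact .awDown _
        · obtain ⟨rfl, -⟩ := s.inst_i h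
          have := h.upper.2 (eraseVal a)
          simpa [atoms, PreFlow.upperEdges, erase_lo] using this
        · have := h.lower.2 (eraseVal a)
          obtain ⟨-, rfl | rfl, -⟩ := s.inst_i h <;>
            simpa [atoms, PreFlow.lowerEdges, erase_up, ← eraseVal_injective.eq_iff, eraseVal_ne]
              using this
      have hd : Deduces ((B.erase s.e₁ s.j s.i .awDown).Inst fun a => x (eraseVal a)) .tru
          (.or .tru (.atom (eraseEdge s.e₂ s.e₂_ne))) [eraseVertex s.i hν] :=
        .nil_trans (.lin (.orUnitInv _)) (.orRight _ (.vertex _ hinst))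
      obtain ⟨rfl, rfl | rfl, -⟩ := s.inst_i h
      · simpa [Formula.bind, eraseSubst_self, eraseSubst_of_ne _ s.e₂_ne] using hd
      · simpa [Formula.bind, eraseSubst_self, eraseSubst_of_ne _ s.e₂_ne] using
          hd.trans_nil (.lin (.orComm ..))
    · exact .vertex _ (h.erase hν hi (by rw [s.up_e₁]; simpa using Ne.symm hi)
        (by rw [s.lo_e₁]; simpa using Ne.symm hν) _)
  · rw [eraseVertexOpt, dif_neg (by simp)]
    have hd : Deduces ((B.erase s.e₁ s.j s.i .awDown).Inst fun a => x (eraseVal a))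
        (.and (.atom (eraseEdge s.e₃ s.e₃_ne)) .tru)
        (.or .fls (.atom (eraseEdge s.e₃ s.e₃_ne))) [] :=
      .nil_trans (.lin (.andUnit _)) <| .nil_trans (.lin (.orUnitInv _)) (.lin (.orComm ..))
    obtain ⟨rfl, rfl | rfl, -⟩ := s.inst_j h
    · simpa [Formula.bind, eraseSubst_self, eraseSubst_of_ne _ s.e₃_ne] using
        Deduces.nil_trans (.lin (.andComm ..)) hd
    · simpa [Formula.bind, eraseSubst_self, eraseSubst_of_ne _ s.e₃_ne] using hd

/-- The dual of `realizes_weakened`, where `e₁` is replaced with `f`. -/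
theorem PreFlow.SimplePair.realizes_coweakened (s : B.SimplePair) {x : B.E → X} {T U : Type}
    {P : Formula T} {Q : Formula U} {p : T → B.E} {q : U → B.E} (hp : ∀ t, p t ≠ s.e₁)
    (hq : ∀ u, q u ≠ s.e₁) (h : B.Realizes x (P.map p) (Q.map q)) :
    (B.erase s.e₁ s.i s.j .awUp).Realizes (fun a => x (eraseVal a))
      (.and (P.map fun t => eraseEdge (p t) (hp t)) (.atom (eraseEdge s.e₂ s.e₂_ne)))
      (Q.map fun u => eraseEdge (q u) (hq u)) := by
  classical
  obtain ⟨vs, h, hvs, hall⟩ := h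
  refine ⟨vs.filterMap eraseVertexOpt, ?_,
    nodup_filterMap_eraseVertex hvs hall⟩
  rw [← map_bind_eraseSubst .fls P hp, ← map_bind_eraseSubst .fls Q hq]
  refine h.bind_and _ _ s.i _ (fun ν hν F G h => ?_) (fun F G h => ?_) hvs (hall _)
  · rw [eraseVertexOpt, dif_pos hν]
    by_cases hj : ν = s.j
    · subst hj
      have hinst : (B.erase s.e₁ s.i s.j .awUp).Inst (fun a => x (eraseVal a)) (eraseVertex s.j hν)
          (.atom (eraseEdge s.e₃ s.e₃_ne)) .tru := by
        refine ⟨?_, ⟨by simp [atoms], fun a => ?_⟩, ⟨by simp [atoms], fun a => ?_⟩⟩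
        · rw [erase_η_self]
          exact .awUp _
        · have := h.upper.2 (eraseVal a)
          obtain ⟨-, rfl | rfl, -⟩ := s.inst_j h <;>
            simpa [atoms, PreFlow.upperEdges, erase_lo, ← eraseVal_injective.eq_iff, eraseVal_ne]
              using this
        · obtain ⟨rfl, -⟩ := s.inst_j h
          have := h.lower.2 (eraseVal a)
          simpa [atoms, PreFlow.lowerEdges, erase_up] using this
      have hd : Deduces ((B.erase s.e₁ s.i s.j .awUp).Inst fun a => x (eraseVal a))
          (.and .fls (.atom (eraseEdge s.e₃ s.e₃_ne))) .fls [eraseVertex s.j hν] :=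
        .trans_nil (.andRight _ (.vertex _ hinst)) (.lin (.andUnit _))
      obtain ⟨rfl, rfl | rfl, -⟩ := s.inst_j h
      · simpa [Formula.bind, eraseSubst_self, eraseSubst_of_ne _ s.e₃_ne] using hd
      · simpa [Formula.bind, eraseSubst_self, eraseSubst_of_ne _ s.e₃_ne] using
          Deduces.nil_trans (.lin (.andComm ..)) hd
    · exact .vertex _ (h.erase hν hj (by rw [s.up_e₁]; simpa using Ne.symm hν)
        (by rw [s.lo_e₁]; simpa using Ne.symm hj) _)
  · rw [eraseVertexOpt, dif_neg (by simp)]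
    have hd : Deduces ((B.erase s.e₁ s.i s.j .awUp).Inst fun a => x (eraseVal a))
        (.and .tru (.atom (eraseEdge s.e₂ s.e₂_ne)))
        (.or (.atom (eraseEdge s.e₂ s.e₂_ne)) .fls) [] :=
      .nil_trans (.lin (.andComm ..)) <| .nil_trans (.lin (.andUnit _)) (.lin (.orUnitInv _))
    obtain ⟨rfl, rfl | rfl, -⟩ := s.inst_i h
    · simpa [Formula.bind, eraseSubst_self, eraseSubst_of_ne _ s.e₂_ne] using
        hd.trans_nil (.lin (.orComm ..))
    · simpa [Formula.bind, eraseSubst_self, eraseSubst_of_ne _ s.e₂_ne] using hd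

end Erase

/-! ### Composing two flows -/

section Compose

variable {X : Type u} {T U : Type}
variable (D' : NamedFlow T (Option U)) (D'' : NamedFlow (Option T) U)

open Classical in
/-- The edges of `D''` in the composition. The upper edge named `none` is represented by the lower
edge of `D'` it is identified with. -/
noncomputable def sndEdge (e : D''.E) : ComposeE D' D'' :=
  if h : e = (D''.top none).1 then .fst (D'.bot none).1 else .snd e h

variable {D' D''}

theorem sndEdge_top_none : sndEdge D' D'' (D''.top none).1 = .fst (D'.bot none).1 :=
  dif_pos rfl

theorem sndEdge_of_ne {e : D''.E} (h : e ≠ (D''.top none).1) :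
    sndEdge D' D'' e = .snd e h :=
  dif_neg h

theorem top_some_ne (t : T) : (D''.top (some t)).1 ≠ (D''.top none).1 := fun h => by
  simpa using D''.top.injective (Subtype.ext h)

theorem sndEdge_injective : Function.Injective (sndEdge D' D'') := by
  intro e e' h
  unfold sndEdge at h
  split at h <;> split at h <;> simp_all

theorem upFst_of_some {e : D'.E} {ν : D'.V} (h : D'.up e = some ν) :
    upFst D' D'' e = some (.fst ν) := by
  unfold upFst
  split <;> simp_all

theorem upFst_top (t : T) : upFst D' D'' (D'.top t).1 = some (.cocontraction t) := by
  have := (D'.top t).2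
  unfold upFst
  split
  · simp_all
  · simp

theorem upSnd_of_some {e : D''.E} {ν : D''.V} (h : D''.up e = some ν) :
    upSnd D' D'' e = some (.snd ν) := by
  unfold upSnd
  split <;> simp_all

theorem upSnd_top (t : T) : upSnd D' D'' (D''.top (some t)).1 = some (.cocontraction t) := by
  have := (D''.top (some t)).2
  unfold upSnd
  split
  · simp_all
  · simp

theorem loSnd_of_some {e : D''.E} {ν : D''.V} (h : D''.lo e = some ν) :
    loSnd D' D'' e = some (.snd ν) := by
  unfold loSnd
  split <;> simp_all

theorem loSnd_bot (u : U) : loSnd D' D'' (D''.bot u).1 = some (.contraction u) := by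
  have := (D''.bot u).2
  unfold loSnd
  split
  · simp_all
  · simp

theorem loFst_of_some {e : D'.E} {ν : D'.V} (h : D'.lo e = some ν) :
    loFst D' D'' e = some (.fst ν) := by
  unfold loFst
  split <;> simp_all

theorem loFst_bot_some (u : U) :
    loFst D' D'' (D'.bot (some u)).1 = some (.contraction u) := by
  have := (D'.bot (some u)).2
  unfold loFst
  split
  · simp_all
  · simp

theorem loFst_bot_none :
    loFst D' D'' (D'.bot none).1 = loSnd D' D'' (D''.top none).1 := by
  have := (D'.bot none).2
  unfold loFst
  split
  · simp_all
  · simp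

theorem compose_lo_sndEdge (e : D''.E) :
    (compose D' D'').lo (sndEdge D' D'' e) = loSnd D' D'' e := by
  by_cases h : e = (D''.top none).1
  · rw [h, sndEdge_top_none]
    exact loFst_bot_none
  · rw [sndEdge_of_ne h]
    rfl

theorem NamedFlow.up_cases {T U : Type} (D : NamedFlow T U) (e : D.E) :
    (∃ ν, D.up e = some ν) ∨ ∃ t, e = (D.top t).1 := by
  rcases h : D.up e with _ | ν
  · exact .inr ⟨D.top.symm ⟨e, h⟩, by simp⟩
  · exact .inl ⟨ν, rfl⟩

theorem NamedFlow.lo_cases {T U : Type} (D : NamedFlow T U) (e : D.E) :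
    (∃ ν, D.lo e = some ν) ∨ ∃ u, e = (D.bot u).1 := by
  rcases h : D.lo e with _ | ν
  · exact .inr ⟨D.bot.symm ⟨e, h⟩, by simp⟩
  · exact .inl ⟨ν, rfl⟩

/-- The possible lower ends of an edge of the composition. -/
theorem compose_lo_cases (c : ComposeE D' D'') :
    (∃ t, c = .upper t ∧ (compose D' D'').lo c = some (.cocontraction t)) ∨
    (∃ u, c = .lower u ∧ (compose D' D'').lo c = none) ∨
    (∃ e ν, c = .fst e ∧ D'.lo e = some ν ∧ (compose D' D'').lo c = some (.fst ν)) ∨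
    (∃ u, c = .fst (D'.bot (some u)).1 ∧ (compose D' D'').lo c = some (.contraction u)) ∨
    (∃ e ν, c = sndEdge D' D'' e ∧ D''.lo e = some ν ∧
      (compose D' D'').lo c = some (.snd ν)) ∨
    ∃ u, c = sndEdge D' D'' (D''.bot u).1 ∧ (compose D' D'').lo c = some (.contraction u) := by
  have hsnd : ∀ e, c = sndEdge D' D'' e → (∃ e ν, c = sndEdge D' D'' e ∧ D''.lo e = some ν ∧
      (compose D' D'').lo c = some (.snd ν)) ∨
      ∃ u, c = sndEdge D' D'' (D''.bot u).1 ∧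
        (compose D' D'').lo c = some (.contraction u) := by
    rintro e rfl
    rcases D''.lo_cases e with ⟨ν, h⟩ | ⟨u, rfl⟩
    · exact .inl ⟨e, ν, rfl, h, (compose_lo_sndEdge e).trans (loSnd_of_some h)⟩
    · exact .inr ⟨u, rfl, (compose_lo_sndEdge _).trans (loSnd_bot u)⟩
  match c with
  | .upper t => exact .inl ⟨t, rfl, rfl⟩
  | .lower u => exact .inr (.inl ⟨u, rfl, rfl⟩)
  | .fst e =>
    rcases D'.lo_cases e with ⟨ν, h⟩ | ⟨u | u, rfl⟩
    · exact .inr (.inr (.inl ⟨e, ν, rfl, h, loFst_of_some h⟩))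
    · exact .inr (.inr (.inr (.inr (hsnd _ sndEdge_top_none.symm))))
    · exact .inr (.inr (.inr (.inl ⟨u, rfl, loFst_bot_some u⟩)))
  | .snd e h => exact .inr (.inr (.inr (.inr (hsnd e (sndEdge_of_ne h).symm))))

/-- The possible upper ends of an edge of the composition. -/
theorem compose_up_cases (c : ComposeE D' D'') :
    (∃ t, c = .upper t ∧ (compose D' D'').up c = none) ∨
    (∃ u, c = .lower u ∧ (compose D' D'').up c = some (.contraction u)) ∨
    (∃ e ν, c = .fst e ∧ D'.up e = some ν ∧ (compose D' D'').up c = some (.fst ν)) ∨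
    (∃ t, c = .fst (D'.top t).1 ∧ (compose D' D'').up c = some (.cocontraction t)) ∨
    (∃ e ν, c = sndEdge D' D'' e ∧ D''.up e = some ν ∧
      (compose D' D'').up c = some (.snd ν)) ∨
    ∃ t, c = sndEdge D' D'' (D''.top (some t)).1 ∧
      (compose D' D'').up c = some (.cocontraction t) := by
  match c with
  | .upper t => exact .inl ⟨t, rfl, rfl⟩
  | .lower u => exact .inr (.inl ⟨u, rfl, rfl⟩)
  | .fst e =>
    rcases D'.up_cases e with ⟨ν, h⟩ | ⟨t, rfl⟩
    · exact .inr (.inr (.inl ⟨e, ν, rfl, h, upFst_of_some h⟩))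
    · exact .inr (.inr (.inr (.inl ⟨t, rfl, upFst_top t⟩)))
  | .snd e he =>
    rcases D''.up_cases e with ⟨ν, h⟩ | ⟨t | t, rfl⟩
    · exact .inr (.inr (.inr (.inr (.inl
        ⟨e, ν, (sndEdge_of_ne he).symm, h, upSnd_of_some h⟩))))
    · exact (he rfl).elim
    · exact .inr (.inr (.inr (.inr (.inr ⟨t, (sndEdge_of_ne he).symm, upSnd_top t⟩))))

theorem upperEdges_fst (ν : D'.V) :
    (compose D' D'').upperEdges (.fst ν) = ComposeE.fst '' D'.upperEdges ν := by
  ext c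
  constructor
  · intro (h : (compose D' D'').lo c = _)
    rcases compose_lo_cases c with ⟨_, -, hc⟩ | ⟨_, -, hc⟩ | ⟨e, ν', rfl, he, hc⟩ |
      ⟨_, -, hc⟩ | ⟨_, _, -, -, hc⟩ | ⟨_, -, hc⟩ <;> rw [h] at hc <;> cases hc
    exact ⟨e, he, rfl⟩
  · rintro ⟨e, he, rfl⟩
    exact loFst_of_some he

theorem lowerEdges_fst (ν : D'.V) :
    (compose D' D'').lowerEdges (.fst ν) = ComposeE.fst '' D'.lowerEdges ν := by
  ext c
  constructor
  · intro (h : (compose D' D'').up c = _)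
    rcases compose_up_cases c with ⟨_, -, hc⟩ | ⟨_, -, hc⟩ | ⟨e, ν', rfl, he, hc⟩ |
      ⟨_, -, hc⟩ | ⟨_, _, -, -, hc⟩ | ⟨_, -, hc⟩ <;> rw [h] at hc <;> cases hc
    exact ⟨e, he, rfl⟩
  · rintro ⟨e, he, rfl⟩
    exact upFst_of_some he

theorem upperEdges_snd (ν : D''.V) :
    (compose D' D'').upperEdges (.snd ν) = sndEdge D' D'' '' D''.upperEdges ν := by
  ext c
  constructor
  · intro (h : (compose D' D'').lo c = _)
    rcases compose_lo_cases c with ⟨_, -, hc⟩ | ⟨_, -, hc⟩ | ⟨_, _, -, -, hc⟩ |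
      ⟨_, -, hc⟩ | ⟨e, _, rfl, he, hc⟩ | ⟨_, -, hc⟩ <;> rw [h] at hc <;> cases hc
    exact ⟨e, he, rfl⟩
  · rintro ⟨e, he, rfl⟩
    exact (compose_lo_sndEdge e).trans (loSnd_of_some he)

theorem lowerEdges_snd (ν : D''.V) :
    (compose D' D'').lowerEdges (.snd ν) = sndEdge D' D'' '' D''.lowerEdges ν := by
  ext c
  constructor
  · intro (h : (compose D' D'').up c = _)
    rcases compose_up_cases c with ⟨_, -, hc⟩ | ⟨_, -, hc⟩ | ⟨_, _, -, -, hc⟩ |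
      ⟨_, -, hc⟩ | ⟨e, _, rfl, he, hc⟩ | ⟨_, -, hc⟩ <;> rw [h] at hc <;> cases hc
    exact ⟨e, he, rfl⟩
  · rintro ⟨e, he, rfl⟩
    have hne : e ≠ (D''.top none).1 := by
      rintro rfl
      have := (D''.top none).2.symm.trans he
      cases this
    rw [sndEdge_of_ne hne]
    exact upSnd_of_some he

theorem mem_upperEdges_cocontraction (t : T) (c : ComposeE D' D'') :
    c ∈ (compose D' D'').upperEdges (.cocontraction t) ↔ c = .upper t := by
  constructor
  · intro (h : (compose D' D'').lo c = _)
    rcases compose_lo_cases c with ⟨_, rfl, hc⟩ | ⟨_, -, hc⟩ | ⟨_, _, -, -, hc⟩ |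
      ⟨_, -, hc⟩ | ⟨_, _, -, -, hc⟩ | ⟨_, -, hc⟩ <;> rw [h] at hc <;> cases hc
    rfl
  · rintro rfl
    rfl

theorem mem_lowerEdges_contraction (u : U) (c : ComposeE D' D'') :
    c ∈ (compose D' D'').lowerEdges (.contraction u) ↔ c = .lower u := by
  constructor
  · intro (h : (compose D' D'').up c = _)
    rcases compose_up_cases c with ⟨_, -, hc⟩ | ⟨_, rfl, hc⟩ | ⟨_, _, -, -, hc⟩ |
      ⟨_, -, hc⟩ | ⟨_, _, -, -, hc⟩ | ⟨_, -, hc⟩ <;> rw [h] at hc <;> cases hc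
    rfl
  · rintro rfl
    rfl

theorem mem_lowerEdges_cocontraction (t : T) (c : ComposeE D' D'') :
    c ∈ (compose D' D'').lowerEdges (.cocontraction t) ↔
      c = .fst (D'.top t).1 ∨ c = sndEdge D' D'' (D''.top (some t)).1 := by
  constructor
  · intro (h : (compose D' D'').up c = _)
    rcases compose_up_cases c with ⟨_, -, hc⟩ | ⟨_, -, hc⟩ | ⟨_, _, -, -, hc⟩ |
      ⟨_, rfl, hc⟩ | ⟨_, _, -, -, hc⟩ | ⟨_, rfl, hc⟩ <;> rw [h] at hc <;> cases hc
    · exact .inl rfl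
    · exact .inr rfl
  · rintro (rfl | rfl)
    · exact upFst_top t
    · rw [sndEdge_of_ne (top_some_ne t)]
      exact upSnd_top t

theorem mem_upperEdges_contraction (u : U) (c : ComposeE D' D'') :
    c ∈ (compose D' D'').upperEdges (.contraction u) ↔
      c = .fst (D'.bot (some u)).1 ∨ c = sndEdge D' D'' (D''.bot u).1 := by
  constructor
  · intro (h : (compose D' D'').lo c = _)
    rcases compose_lo_cases c with ⟨_, -, hc⟩ | ⟨_, -, hc⟩ | ⟨_, _, -, -, hc⟩ |
      ⟨_, rfl, hc⟩ | ⟨_, _, -, -, hc⟩ | ⟨_, rfl, hc⟩ <;> rw [h] at hc <;> cases hc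
    · exact .inl rfl
    · exact .inr rfl
  · rintro (rfl | rfl)
    · exact loFst_bot_some u
    · exact (compose_lo_sndEdge _).trans (loSnd_bot u)

theorem enumerates_atom {E : Type*} {a : E} {S : Set E} (h : ∀ c, c ∈ S ↔ c = a) :
    (atom a).Enumerates S :=
  ⟨List.nodup_singleton a, fun c => List.mem_singleton.trans (h c).symm⟩

theorem nodup_pair {E : Type*} {a b : E} {S : Set E} (hab : a ≠ b)
    (h : ∀ c, c ∈ S ↔ c = a ∨ c = b) :
    ([a] ++ [b]).Nodup ∧ ∀ c, c ∈ [a] ++ [b] ↔ c ∈ S := by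
  simp [hab, h]

/-- The labelling of the composition that extends labellings of `D'` and `D''`. -/
def composeLabel (τ : T → X) (υ : U → X) (x' : D'.E → X) (x'' : D''.E → X) :
    ComposeE D' D'' → X
  | .upper t => τ t
  | .lower u => υ u
  | .fst e => x' e
  | .snd e _ => x'' e

theorem composeLabel_sndEdge {τ : T → X} {υ : U → X} {x' : D'.E → X} {x'' : D''.E → X}
    (h : x' (D'.bot none).1 = x'' (D''.top none).1) (e : D''.E) :
    composeLabel τ υ x' x'' (sndEdge D' D'' e) = x'' e := by
  by_cases he : e = (D''.top none).1
  · rw [he, sndEdge_top_none]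
    exact h
  · rw [sndEdge_of_ne he]
    rfl

variable [Atoms X]

/-- The deduction for the composition: duplicate the premiss by cocontractions, use `D'` on one
copy, move the surplus disjunct next to the other copy by a switch, use `D''` there, and merge the
two copies of the conclusion by contractions. -/
theorem realizes_compose {P : Formula T} {Q : Formula U} (hP : P.Enumerates Set.univ)
    (hQ : Q.Enumerates Set.univ) {τ : T → X} {υ : U → X} {x' : D'.E → X} {x'' : D''.E → X}
    (hx : x' (D'.bot none).1 = x'' (D''.top none).1) (hτ' : ∀ t, x' (D'.top t).1 = τ t)
    (hτ'' : ∀ t, x'' (D''.top (some t)).1 = τ t) (hυ' : ∀ u, x' (D'.bot (some u)).1 = υ u)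
    (hυ'' : ∀ u, x'' (D''.bot u).1 = υ u)
    (h' : D'.Realizes x' (P.map fun t => (D'.top t).1)
      (.or (Q.map fun u => (D'.bot (some u)).1) (.atom (D'.bot none).1)))
    (h'' : D''.Realizes x'' (.and (P.map fun t => (D''.top (some t)).1) (.atom (D''.top none).1))
      (Q.map fun u => (D''.bot u).1)) :
    (compose D' D'').Realizes (composeLabel τ υ x' x'')
      (P.map ComposeE.upper) (Q.map ComposeE.lower) := by
  obtain ⟨vs, h', hvs, hvs_all⟩ := h'
  obtain ⟨ws, h'', hws, hws_all⟩ := h''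
  let R : ComposeV D' D'' → Formula (ComposeE D' D'') → Formula (ComposeE D' D'') → Prop :=
    (compose D' D'').Inst (composeLabel τ υ x' x'')
  have hfst : Function.Injective (ComposeE.fst : D'.E → ComposeE D' D'') := fun _ _ h => by
    cases h; rfl
  have d₁ := h'.map (R' := R) ComposeE.fst
    ComposeV.fst fun ν F G h => h.map rfl (upperEdges_fst ν) (lowerEdges_fst ν) hfst.injOn
      hfst.injOn (fun _ _ => rfl) fun _ _ => rfl
  have d₂ := h''.map (R' := R) (sndEdge D' D'')
    ComposeV.snd fun ν F G h => h.map rfl (upperEdges_snd ν) (lowerEdges_snd ν)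
      sndEdge_injective.injOn sndEdge_injective.injOn (fun e _ => composeLabel_sndEdge hx e)
      fun e _ => composeLabel_sndEdge hx e
  have d₀ := Deduces.cocontraction (R := R) P
    (fun t => .fst (D'.top t).1) (fun t => sndEdge D' D'' (D''.top (some t)).1)
    ComposeE.upper ComposeV.cocontraction fun t =>
      ⟨.acUp _ _ _ (hτ' t) ((composeLabel_sndEdge hx _).trans (hτ'' t)),
        enumerates_atom (mem_upperEdges_cocontraction t),
        nodup_pair (by rw [sndEdge_of_ne (top_some_ne t)]; nofun) (mem_lowerEdges_cocontraction t)⟩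
  have hne : ∀ u, ComposeE.fst (D'.bot (some u)).1 ≠ sndEdge D' D'' (D''.bot u).1 := by
    intro u h
    by_cases hu : (D''.bot u).1 = (D''.top none).1
    · rw [hu, sndEdge_top_none] at h
      simpa using D'.bot.injective (Subtype.ext (hfst h))
    · rw [sndEdge_of_ne hu] at h
      cases h
  have d₃ := Deduces.contraction (R := R) Q
    (fun u => .fst (D'.bot (some u)).1) (fun u => sndEdge D' D'' (D''.bot u).1)
    ComposeE.lower ComposeV.contraction fun u =>
      ⟨.acDown _ _ _ (hυ' u) ((composeLabel_sndEdge hx _).trans (hυ'' u)),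
        nodup_pair (hne u) (mem_upperEdges_contraction u),
        enumerates_atom (mem_lowerEdges_contraction u)⟩
  simp only [map_map, map_or, map_and, map_atom, sndEdge_top_none] at d₁ d₂
  let us : List (ComposeV D' D'') := P.atoms.map .cocontraction ++ vs.map .fst ++
    (ws.map .snd ++ Q.atoms.map .contraction)
  have hus : us.Nodup := by
    have hco : Function.Injective (ComposeV.cocontraction : T → ComposeV D' D'') :=
      fun _ _ h => by cases h; rfl
    have hcon : Function.Injective (ComposeV.contraction : U → ComposeV D' D'') :=
      fun _ _ h => by cases h; rfl
    have hf : Function.Injective (ComposeV.fst : D'.V → ComposeV D' D'') :=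
      fun _ _ h => by cases h; rfl
    have hs : Function.Injective (ComposeV.snd : D''.V → ComposeV D' D'') :=
      fun _ _ h => by cases h; rfl
    simp only [us, List.nodup_append, hP.1.map hco, hQ.1.map hcon, hvs.map hf, hws.map hs,
      List.mem_append, List.mem_map]
    grind
  have hall : ∀ ν, ν ∈ us := by
    rintro (t | u | ν | ν)
    · simpa [us] using (hP.2 t).2 trivial
    · simpa [us] using (hQ.2 u).2 trivial
    · simpa [us] using hvs_all ν
    · simpa [us] using hws_all ν
  exact ⟨us, (d₀.trans (.trans_nil (.andLeft d₁ _) <| .nil_trans (.lin (.andComm ..)) <|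
    .nil_trans (.andRight _ (.lin (.orComm ..))) <| .lin (.switch ..))).trans
    ((Deduces.trans_nil (.orLeft d₂ _) (.lin (.orComm ..))).trans d₃), hus, hall⟩

end Compose

/-! ### Soundness -/

section Sound

variable {X : Type u} [Atoms X] {halt : PreFlow → Prop} {select : (B : PreFlow) → B.E → Prop}

/-- Soundness for flows with named edges. The formulae `P` and `Q` over the names stand for the
premiss and the conclusion, so that they can be kept fixed while the flow changes. -/
theorem Reduces.exists_realizes {T U : Type} {B C : NamedFlow T U} (h : Reduces halt select B C)
    {P : Formula T} {Q : Formula U} (hP : P.Enumerates Set.univ) (hQ : Q.Enumerates Set.univ)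
    {x : B.E → X}
    (hB : B.Realizes x (P.map fun t => (B.top t).1) (Q.map fun u => (B.bot u).1)) :
    ∃ y : C.E → X, (∀ t, y (C.top t).1 = x (B.top t).1) ∧
      (∀ u, y (C.bot u).1 = x (B.bot u).1) ∧
      C.Realizes y (P.map fun t => (C.top t).1) (Q.map fun u => (C.bot u).1) := by
  induction h with
  | @base T U B C φ htop hbot _ =>
    refine ⟨fun e => x (φ.e e), fun t => congrArg x (htop t), fun u => congrArg x (hbot u), ?_⟩
    simpa only [map_map, ← htop, ← hbot, Equiv.symm_apply_apply] using hB.iso φ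
  | @step T U B C s _ B' D' B'' D'' hB' hB'' _ _ φ htop hbot ih' ih'' =>
    obtain ⟨φ', ht', hb', hbn'⟩ := hB'
    obtain ⟨φ'', ht'', htn'', hb''⟩ := hB''
    replace ht' : ∀ t, eraseVal (φ'.e (B'.top t).1) = (B.top t).1 := ht'
    replace hb' : ∀ u, eraseVal (φ'.e (B'.bot (some u)).1) = (B.bot u).1 := hb'
    replace hbn' : eraseVal (φ'.e (B'.bot none).1) = s.e₃ := hbn'
    replace ht'' : ∀ t, eraseVal (φ''.e (B''.top (some t)).1) = (B.top t).1 := ht''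
    replace htn'' : eraseVal (φ''.e (B''.top none).1) = s.e₂ := htn''
    replace hb'' : ∀ u, eraseVal (φ''.e (B''.bot u).1) = (B.bot u).1 := hb''
    have hp : ∀ t, (B.top t).1 ≠ s.e₁ := fun t h => by
      have := (B.top t).2.symm.trans (h ▸ s.up_e₁)
      cases this
    have hq : ∀ u, (B.bot u).1 ≠ s.e₁ := fun u h => by
      have := (B.bot u).2.symm.trans (h ▸ s.lo_e₁)
      cases this
    have r' : B'.Realizes (fun e => x (eraseVal (φ'.e e))) (P.map fun t => (B'.top t).1)
        ((Formula.or (Q.map some) (.atom none)).map fun u => (B'.bot u).1) := by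
      have h := (s.realizes_weakened hp hq hB).iso φ'
      have e₁ : ∀ t, φ'.e.symm (eraseEdge (B.top t).1 (hp t)) = (B'.top t).1 := fun t =>
        φ'.e.symm_apply_eq.2 (Subtype.ext (ht' t).symm)
      have e₂ : ∀ u, φ'.e.symm (eraseEdge (B.bot u).1 (hq u)) = (B'.bot (some u)).1 := fun u =>
        φ'.e.symm_apply_eq.2 (Subtype.ext (hb' u).symm)
      have e₃ : φ'.e.symm (eraseEdge s.e₃ s.e₃_ne) = (B'.bot none).1 :=
        φ'.e.symm_apply_eq.2 (Subtype.ext hbn'.symm)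
      simpa only [map_or, map_atom, map_map, e₁, e₂, e₃] using h
    have r'' : B''.Realizes (fun e => x (eraseVal (φ''.e e)))
        ((Formula.and (P.map some) (.atom none)).map fun t => (B''.top t).1)
        (Q.map fun u => (B''.bot u).1) := by
      have h := (s.realizes_coweakened hp hq hB).iso φ''
      have e₁ : ∀ t, φ''.e.symm (eraseEdge (B.top t).1 (hp t)) = (B''.top (some t)).1 := fun t =>
        φ''.e.symm_apply_eq.2 (Subtype.ext (ht'' t).symm)
      have e₂ : ∀ u, φ''.e.symm (eraseEdge (B.bot u).1 (hq u)) = (B''.bot u).1 := fun u =>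
        φ''.e.symm_apply_eq.2 (Subtype.ext (hb'' u).symm)
      have e₃ : φ''.e.symm (eraseEdge s.e₂ s.e₂_ne) = (B''.top none).1 :=
        φ''.e.symm_apply_eq.2 (Subtype.ext htn''.symm)
      simpa only [map_and, map_atom, map_map, e₁, e₂, e₃] using h
    have hlist : ∀ {S : Type} {F : Formula S}, F.Enumerates Set.univ →
        (F.atoms.map some ++ [none]).Nodup ∧ ∀ o, o ∈ F.atoms.map some ++ [none] := by
      intro S F hF
      refine ⟨?_, fun o => ?_⟩
      · simp [List.nodup_append, hF.1.map (Option.some_injective S)]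
      · cases o <;> simp [hF.2]
    obtain ⟨y', ht₁, hb₁, h₁⟩ := ih' hP
      (by simpa [Enumerates, atoms] using hlist hQ) r'
    obtain ⟨y'', ht₂, hb₂, h₂⟩ := ih''
      (by simpa [Enumerates, atoms] using hlist hP) hQ r''
    simp only [map_or, map_and, map_atom, map_map] at h₁ h₂
    have hr := (realizes_compose hP hQ (τ := fun t => x (B.top t).1)
      (υ := fun u => x (B.bot u).1)
      (by rw [hb₁, ht₂, hbn', htn'', s.label_eq hB]) (fun t => by rw [ht₁, ht'])
      (fun t => by rw [ht₂, ht'']) (fun u => by rw [hb₁, hb']) (fun u => by rw [hb₂, hb''])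
      h₁ h₂).iso φ
    have eP : Formula.map (E := (compose D' D'').E) (P.map ComposeE.upper) φ.e.symm =
        P.map fun t => (C.top t).1 :=
      (map_map ..).trans <| map_congr fun t _ => φ.e.symm_apply_eq.2 (htop t).symm
    have eQ : Formula.map (E := (compose D' D'').E) (Q.map ComposeE.lower) φ.e.symm =
        Q.map fun u => (C.bot u).1 :=
      (map_map ..).trans <| map_congr fun u _ => φ.e.symm_apply_eq.2 (hbot u).symm
    rw [eP, eQ] at hr
    exact ⟨_, fun t => congrArg (composeLabel _ _ y' y'') (htop t),
      fun u => congrArg (composeLabel _ _ y' y'') (hbot u), hr⟩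

theorem Formula.Enumerates.map_equiv {S E : Type*} {p : E → Prop} {P : Formula S}
    (h : P.Enumerates Set.univ) (φ : S ≃ Subtype p) :
    (P.map fun t => (φ t).1).Enumerates {e | p e} := by
  convert h.map (g := fun t => (φ t).1) (Subtype.val_injective.comp φ.injective).injOn
  exact Set.ext fun e => ⟨fun he => ⟨φ.symm ⟨e, he⟩, trivial, by simp⟩,
    by rintro ⟨t, -, rfl⟩; exact (φ t).2⟩

theorem sound_reducesTo : Sound X (ReducesTo halt select) := by
  rintro A B ⟨top, bot, h⟩ α β Φ hΦ
  obtain ⟨x, F, G, hA, rfl, rfl, hF, hG⟩ := hΦ.exists_realizes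
  obtain ⟨P, rfl⟩ := F.exists_map_val fun e he => (hF.2 e).1 he
  obtain ⟨Q, rfl⟩ := G.exists_map_val fun e he => (hG.2 e).1 he
  have huniv : ∀ {S : Set A.E} {P : Formula S}, (P.map Subtype.val).Enumerates S →
      P.Enumerates Set.univ := by
    intro S P h
    refine ⟨.of_map Subtype.val (by simpa using h.1), fun e => ?_⟩
    simpa using (h.2 e.1).2 e.2
  have hP := huniv hF
  have hQ := huniv hG
  obtain ⟨y, ht, hb, hB⟩ : ∃ y : B.E → X, (∀ t : A.Upper, y (top t).1 = x t.1) ∧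
      (∀ u : A.Lower, y (bot u).1 = x u.1) ∧
      B.Realizes y (P.map fun t => (top t).1) (Q.map fun u => (bot u).1) :=
    h.exists_realizes hP hQ hA
  have h := hB.exists_hasFlow (hP.map_equiv top) (hQ.map_equiv bot)
  have hα : (P.map fun t => (top t).1).map y = (P.map Subtype.val).map x := by
    simp only [map_map, ht]
  have hβ : (Q.map fun u => (bot u).1).map y = (Q.map Subtype.val).map x := by
    simp only [map_map, hb]
  rwa [hα, hβ] at h

end Sound

end AtomicFlows

theorem mainTheorem6 (X : Type*) [AtomicFlows.Atoms X] :
    AtomicFlows.Sound X AtomicFlows.BC ∧ AtomicFlows.Sound X AtomicFlows.EX :=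
  ⟨AtomicFlows.sound_reducesTo, AtomicFlows.sound_reducesTo⟩
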